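/- Let $d\ge 1$ be an integer, and write $Q(x,x)=x_1^2+\dots+x_d^2$. For a prime $p$ and a function $f:(\mathbb Z/p\mathbb Z)^d\to\mathbb C$ define, on the upper half-plane, $$\theta_f(\tau)=\sum_{x\in\mathbb Z^d} f(x \bmod p)\,e^{2\pi i Q(x,x)\tau}.$$ For odd $p$ and $a\in\mathbb Z/p\mathbb Z$ let $X_{p,d}(a)=\{x\in(\mathbb Z/p\mathbb Z)^d: Q(x,x)=a\}$. For $a\in\mathbb Z/4\mathbb Z$ let $X_{2,d}(a)=\{x\in(\mathbb Z/2\mathbb Z)^d: Q(x,x)=a \text{ in } \mathbb Z/4\mathbb Z\}$, where $Q(x,x)\bmod 4$ is computed on any integral lift of $x$. Let $$\Gamma_2=\{\begin{pmatrix}a&b\\c&e\end{pmatrix}\in \mathrm{SL}_2(\mathbb Z): a,e\equiv 1\ (4),\ c\equiv 0\ (16)\},$$ $$\Gamma_p=\{\begin{pmatrix}a&b\\c&e\end{pmatrix}\in \mathrm{SL}_2(\mathbb Z): a,e\equiv 1\ (4p),\ c\equiv 0\ (4p^2)\}\quad(p \text{ odd}).$$ For $k\in\frac12\mathbb Z$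 and a congruence subgroup $\Gamma\subseteq\Gamma_1(4)$, a holomorphic function $\psi$ on the upper half-plane is a cusp form of weight $k$ under $\Gamma$ if the following hold. 1. $\psi(\tau)=h(g,\tau)^{-2k}\psi(g\tau)$ for all $g\in\Gamma$ and all $\tau$. Here $h(g,\tau)=\varepsilon_e^{-1}\left(\frac{c}{e}\right)\sqrt{c\tau+e}$ for $g=\begin{pmatrix}a&b\\c&e\end{pmatrix}$ is the theta multiplier, with the principal square root and $\varepsilon_e=1$ or $i$ according as $e\equiv 1$ or $3\pmod 4$. The symbol $\left(\frac{c}{e}\right)$ is the Jacobi symbol for $e>0$, extended to negative odd $e$ by $\left(\frac{c}{e}\right)=\frac{c}{|c|}\left(\frac{c}{-e}\right)$ for $c\ne0$, with $\left(\frac{0}{\pm1}\right)=1$. 2. $\psi$ is zero at $\infty$: for some integer $m\ge1$ it has an expansion $\psi(\tau)=\sum_{n\ge 0}a_ne^{2\pi i n\tau/m}$ with $a_0=0$. 3. $\psi$ is zero at every $s\in\mathbb Q$: there are $g=\begin{pmatrix}a&b\\c&e\end{pmatrix}\in \mathrm{GL}_2^+(\mathbb Q)$ with $g\cdot s=\infty$,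 a holomorphic $\phi$ on the upper half-plane with $\phi(\tau)^2=c\tau+e$, and $u\in\mathbb C$, such that the function $\tau\mapsto \phi(g^{-1}\tau)^{2k}\det(g)^{-u}\psi(g^{-1}\tau)$ is zero at $\infty$ in the sense of 2. **Theorem.** Let $d\ge1$. 1. Let $f:(\mathbb Z/2\mathbb Z)^d\to\mathbb C$. Then $\theta_f$ is a cusp form of weight $d/2$ under $\Gamma_2$ if and only if $$\sum_{x\in X_{2,d}(a)}f(x)=0\ \text{ for all } a\in\mathbb Z/4\mathbb Z,\qquad f(1,\dots,1)=0,\qquad f(0,\dots,0)=0.$$ 2. Let $p$ be an odd prime and $f:(\mathbb Z/p\mathbb Z)^d\to\mathbb C$. Then $\theta_f$ is a cusp form of weight $d/2$ under $\Gamma_p$ if and only if $$\sum_{x\in X_{p,d}(a)}f(x)=0\ \text{ for all } a\in\mathbb Z/p\mathbb Z,\qquad f(0,\dots,0)=0.$$ -/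

import Mathlib

open scoped UpperHalfPlane MatrixGroups Manifold

noncomputable section

namespace WeightedTheta

/-! ### Quadrics over `ℤ/pℤ` and the weighted theta function -/

/-- `X_{p,d}(a)`: the `x ∈ (ℤ/pℤ)^d` with `Q(x,x) = x₁² + ⋯ + x_d² = a` in `ℤ/pℤ`. -/
def quadric (p d : ℕ) [NeZero p] (a : ZMod p) : Finset (Fin d → ZMod p) :=
  Finset.univ.filter fun x => ∑ i, x i * x i = a

/-- The map `(ℤ/2ℤ)^d → ℤ/4ℤ`, `x ↦ Q(x,x)`, computed on the representatives `0`, `1`;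
it does not depend on the integral representatives, see `qFour_intCast`. -/
def qFour {d : ℕ} (x : Fin d → ZMod 2) : ZMod 4 :=
  ∑ i, ((x i).val : ZMod 4) * ((x i).val : ZMod 4)

theorem qFour_intCast {d : ℕ} (y : Fin d → ℤ) :
    qFour (fun i => (y i : ZMod 2)) = ((∑ i, y i * y i : ℤ) : ZMod 4) := by
  unfold qFour
  push_cast
  refine Finset.sum_congr rfl fun i _ => ?_
  have key : ∀ z : ZMod 4, (((ZMod.castHom (by norm_num : 2 ∣ 4) (ZMod 2) z).val : ℕ) : ZMod 4) *
      (((ZMod.castHom (by norm_num : 2 ∣ 4) (ZMod 2) z).val : ℕ) : ZMod 4) = z * z := by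
    decide
  simpa using key (y i : ZMod 4)

/-- `X_{2,d}(a)` for `a ∈ ℤ/4ℤ`: the `x ∈ (ℤ/2ℤ)^d` with `Q(x,x) = a` in `ℤ/4ℤ`. -/
def quadricTwo (d : ℕ) (a : ZMod 4) : Finset (Fin d → ZMod 2) :=
  Finset.univ.filter fun x => qFour x = a

/-- The weighted theta function
`θ_f(τ) = ∑_{x ∈ ℤ^d} f(x mod p) exp(2π i Q(x,x) τ)` (an absolutely convergent series). -/
def theta {p d : ℕ} (f : (Fin d → ZMod p) → ℂ) (τ : ℍ) : ℂ :=
  ∑' x : Fin d → ℤ, f (fun i => (x i : ZMod p)) *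
    Complex.exp (2 * Real.pi * Complex.I * ((∑ i, x i * x i : ℤ) : ℂ) * (τ : ℂ))

/-! ### The theta multiplier on `Γ₀(4)` -/

/-- The extended quadratic symbol `(c/d)`, for `c ∈ ℤ` and odd `d ∈ ℤ`: the Jacobi symbol for
`d > 0`, `(0/d) = 1` if `d = ±1` and `0` otherwise, and
`(c/d) = (c/|c|) (c/(-d))` for `d < 0` and `c ≠ 0`. -/
def quadSymbol (c d : ℤ) : ℤ :=
  if c = 0 then (if d = 1 ∨ d = -1 then 1 else 0)
  else if d < 0 then c.sign * jacobiSym c d.natAbs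
  else jacobiSym c d.natAbs

/-- `ε_d` for odd `d`: it is `1` if `d ≡ 1 mod 4` and `i` if `d ≡ 3 mod 4`. -/
def eps (d : ℤ) : ℂ := if d % 4 = 1 then 1 else Complex.I

/-- `h(g,τ) = ε_d⁻¹ (c/d) √(cτ + d)` for `g = (a b; c d) ∈ Γ₀(4)`, principal square root. -/
def thetaMultiplier (g : SL(2, ℤ)) (τ : ℍ) : ℂ :=
  (eps (g 1 1))⁻¹ * (quadSymbol (g 1 0) (g 1 1) : ℂ) *
    ((g 1 0 : ℂ) * (τ : ℂ) + (g 1 1 : ℂ)) ^ (1 / 2 : ℂ)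

/-- `ψ` is weakly modular of weight `k = n/2` under (the lift by `h` of) `Γ ⊆ Γ₁(4)`:
for all `g ∈ Γ`, `([g̃]_k ψ)(τ) = h(g⁻¹,τ)^{-2k} ψ(g⁻¹ τ)` equals `ψ(τ)`. -/
def IsWeaklyModular (n : ℤ) (Γ : Subgroup SL(2, ℤ)) (ψ : ℍ → ℂ) : Prop :=
  ∀ g ∈ Γ, ∀ τ : ℍ, thetaMultiplier g⁻¹ τ ^ (-n) * ψ (g⁻¹ • τ) = ψ τ

/-! ### The metaplectic group over `GL₂⁺(ℚ)` and its action on functions -/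

/-- A rational matrix seen as a real one (Mathlib lets `GL₂(ℝ)` act on `ℍ`, by
`τ ↦ (aτ+b)/(cτ+d)` if the determinant is positive). -/
def toReal (g : GL (Fin 2) ℚ) : GL (Fin 2) ℝ :=
  Matrix.GeneralLinearGroup.map (Rat.castHom ℝ) g

/-- `j(g,τ) = cτ + d`. -/
def autFactor (g : GL (Fin 2) ℚ) (τ : ℍ) : ℂ := ((g 1 0 : ℚ) : ℂ) * (τ : ℂ) + ((g 1 1 : ℚ) : ℂ)

/-- The metaplectic group: pairs `(g, φ)` with `g ∈ GL₂⁺(ℚ)` and `φ : ℍ → ℂ` holomorphic such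
that `φ(τ)² = j(g,τ)`. -/
structure Metaplectic where
  /-- the matrix -/
  mat : GL (Fin 2) ℚ
  det_pos : 0 < (mat.det : ℚ)
  /-- the chosen square root of `j` -/
  root : ℍ → ℂ
  holo : MDifferentiable 𝓘(ℂ) 𝓘(ℂ) root
  root_sq : ∀ τ, root τ ^ 2 = autFactor mat τ

theorem toReal_det_pos {g : GL (Fin 2) ℚ} (hg : 0 < (g.det : ℚ)) :
    0 < ((toReal g).det : ℝ) := by
  have h : ((toReal g).det : ℝ) = (((g.det : ℚ)) : ℝ) := by
    simp [toReal, Matrix.det_fin_two]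
  rw [h]
  exact_mod_cast hg

theorem autFactor_eq_denom (g : GL (Fin 2) ℚ) (τ : ℍ) :
    autFactor g τ = UpperHalfPlane.denom (toReal g) τ := by
  simp [autFactor, toReal, UpperHalfPlane.denom]

theorem autFactor_inv {g : GL (Fin 2) ℚ} (hg : 0 < (g.det : ℚ)) (τ : ℍ) :
    autFactor g (toReal g⁻¹ • τ) * autFactor g⁻¹ τ = 1 := by
  have hg' : 0 < (g⁻¹.det : ℚ) := by simpa using hg
  have h := UpperHalfPlane.denom_cocycle (toReal g) (toReal g⁻¹) (z := (τ : ℂ)) τ.im_ne_zero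
  have h1 : toReal g * toReal g⁻¹ = 1 := by
    rw [toReal, toReal, ← map_mul, mul_inv_cancel, map_one]
  rw [h1] at h
  rw [autFactor_eq_denom, autFactor_eq_denom]
  rw [UpperHalfPlane.coe_smul_of_det_pos (toReal_det_pos hg')]
  rw [← h]
  simp [UpperHalfPlane.denom]

/-- The inverse for the product `(g₁,φ₁)(g₂,φ₂) = (g₁g₂, τ ↦ φ₁(g₂τ) φ₂(τ))`, that is,
`(g,φ)⁻¹ = (g⁻¹, τ ↦ φ(g⁻¹τ)⁻¹)`. -/
def Metaplectic.inv (h : Metaplectic) : Metaplectic where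
  mat := h.mat⁻¹
  det_pos := by simpa using h.det_pos
  root := fun τ => (h.root (toReal h.mat⁻¹ • τ))⁻¹
  holo := by
    have hg' : 0 < (h.mat⁻¹.det : ℚ) := by simpa using h.det_pos
    have h1 : MDifferentiable 𝓘(ℂ) 𝓘(ℂ) (fun τ : ℍ => h.root (toReal h.mat⁻¹ • τ)) :=
      h.holo.comp (UpperHalfPlane.mdifferentiable_smul (toReal_det_pos hg'))
    rw [UpperHalfPlane.mdifferentiable_iff] at h1 ⊢
    refine h1.inv fun z _ h0 => ?_
    have h2 := autFactor_inv h.det_pos (UpperHalfPlane.ofComplex z)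
    rw [← h.root_sq] at h2
    simp only [Function.comp_apply] at h0
    simp [h0] at h2
  root_sq := fun τ => by
    have := autFactor_inv h.det_pos τ
    rw [inv_pow, h.root_sq]
    exact (eq_inv_of_mul_eq_one_right this).symm

/-- The action `([ġ]_{k,u} ψ)(τ) = φ_{ġ⁻¹}(τ)^{-2k} det(g)^{-u} ψ(g⁻¹ τ)`, of weight `k = n/2`,
where `φ_{ġ⁻¹}` is the second component of `ġ⁻¹`. -/
def metaAct (n : ℤ) (u : ℂ) (g : Metaplectic) (ψ : ℍ → ℂ) (τ : ℍ) : ℂ :=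
  g.inv.root τ ^ (-n) * (((g.mat.det : ℚ) : ℂ) ^ (-u)) * ψ (toReal g.mat⁻¹ • τ)

/-! ### Behaviour at the cusps, modular forms and cusp forms -/

/-- `ψ(τ) = ∑_{n ≥ 0} aₙ exp(2π i n τ / m)` on `ℍ`. -/
def HasFourierExpansion (ψ : ℍ → ℂ) (m : ℕ) (a : ℕ → ℂ) : Prop :=
  ∀ τ : ℍ, HasSum (fun n : ℕ => a n * Complex.exp (2 * Real.pi * Complex.I * (τ : ℂ) / m) ^ n)
    (ψ τ)

def IsHolomorphicAtInfty (ψ : ℍ → ℂ) : Prop :=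
  ∃ m : ℕ, 0 < m ∧ ∃ a : ℕ → ℂ, HasFourierExpansion ψ m a

def IsZeroAtInfty (ψ : ℍ → ℂ) : Prop :=
  ∃ m : ℕ, 0 < m ∧ ∃ a : ℕ → ℂ, HasFourierExpansion ψ m a ∧ a 0 = 0

/-- `ψ` is holomorphic at `s ∈ ℚ` in weight `n/2`: it becomes holomorphic at `∞` when moved
there by some metaplectic element whose matrix maps `s` to `∞` in `ℙ¹(ℚ) = ℚ ∪ {∞}`. -/
def IsHolomorphicAtRat (n : ℤ) (ψ : ℍ → ℂ) (s : ℚ) : Prop :=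
  ∃ (h : Metaplectic) (u : ℂ), h.mat • (s : OnePoint ℚ) = OnePoint.infty ∧
    IsHolomorphicAtInfty (metaAct n u h ψ)

def IsZeroAtRat (n : ℤ) (ψ : ℍ → ℂ) (s : ℚ) : Prop :=
  ∃ (h : Metaplectic) (u : ℂ), h.mat • (s : OnePoint ℚ) = OnePoint.infty ∧
    IsZeroAtInfty (metaAct n u h ψ)

/-- Modular forms of weight `n/2` under a congruence subgroup `Γ ⊆ Γ₁(4)`. -/
structure IsModularForm (n : ℤ) (Γ : Subgroup SL(2, ℤ)) (ψ : ℍ → ℂ) : Prop where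
  holo : MDifferentiable 𝓘(ℂ) 𝓘(ℂ) ψ
  weaklyModular : IsWeaklyModular n Γ ψ
  holo_infty : IsHolomorphicAtInfty ψ
  holo_rat : ∀ s : ℚ, IsHolomorphicAtRat n ψ s

/-- Cusp forms of weight `n/2` under a congruence subgroup `Γ ⊆ Γ₁(4)`. -/
structure IsCuspForm (n : ℤ) (Γ : Subgroup SL(2, ℤ)) (ψ : ℍ → ℂ) : Prop
    extends IsModularForm n Γ ψ where
  zero_infty : IsZeroAtInfty ψ
  zero_rat : ∀ s : ℚ, IsZeroAtRat n ψ s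

/-! ### The levels -/

/-- `Γ₂ = {(a b; c d) ∈ SL₂(ℤ) : a, d ≡ 1 mod 4, c ≡ 0 mod 16}`. -/
def levelTwo : Subgroup SL(2, ℤ) :=
  CongruenceSubgroup.Gamma1 4 ⊓ CongruenceSubgroup.Gamma0 16

/-- `Γ_p = {(a b; c d) ∈ SL₂(ℤ) : a, d ≡ 1 mod 4p, c ≡ 0 mod 4p²}` for odd `p`. -/
def levelOdd (p : ℕ) : Subgroup SL(2, ℤ) :=
  CongruenceSubgroup.Gamma1 (4 * p) ⊓ CongruenceSubgroup.Gamma0 (4 * p ^ 2)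

end WeightedTheta

end

open scoped UpperHalfPlane MatrixGroups Manifold

noncomputable section

namespace WeightedTheta

open Complex Real ZMod Filter Topology

/-! Holomorphy, the transformation law and holomorphy at all cusps hold for every weight `f`; only
vanishing at the cusps constrains it. At `∞` the constant term is `f 0`. Write a rational cusp as
`A/M` with `p ∣ M`. Translation by `A/M` multiplies the weight by the character `e(A Q(x,x)/M)` on
`(ℤ/Mℤ)^d`, and Poisson summation (`theta_neg_one_div`) turns `A/M - 1/τ` into a theta series
weighted by the Fourier transform. Its constant term is the sum of `cuspTwist` over all residues.
Hence (`isCuspForm_theta_iff`) `θ_f` is a cusp form iff `f 0 = 0` and all these sums vanish.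

Each such sum equals `∑ r, f r * ∏ i, localSum h A (r i)`, where `localSum` is a Gauss sum over one
class mod `p`. Let `A/M = a/c` in lowest terms. For odd `p` with `p² ∤ c`, `localSum` at `r` is an
additive character mod `p` at a multiple of `r²`, times `localSum` at `0`, so the total is a
combination of the sums of `f` over quadrics. If `p² ∣ c`, translation by `c/p` kills every class `r
≠ 0` and leaves only `f 0`. For `p = 2` the quadrics mod 4 account for `8 ∤ c`; when 8 exactly
divides `c` only `f (1,…,1)` survives, and when `16 ∣ c` only `f 0`. Conversely, `M = p` (or `M =
4`) and Fourier inversion recover the quadric sums, and `M = 8` recovers `f (1,…,1)`.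

The transformation law reduces to one variable, since `θ_f` is a combination of products of
one-variable series. There two Poisson summations around the translation by `b/D` produce the Gauss
sum `quadGauss D b`, whose exact value, sign included, is the theta multiplier (`quadGauss_eq`,
`thetaSeries_smul`). -/

/-! ### One-variable theta series and Jacobi's theta function -/

/-- The one-variable series `∑_{x ∈ ℤ} F(x mod N) exp(2πi x² τ)`. -/
def thetaSeries {N : ℕ} (F : ZMod N → ℂ) (τ : ℂ) : ℂ :=
  ∑' x : ℤ, F x * cexp (2 * π * I * (x : ℂ) ^ 2 * τ)

theorem jacobiTheta₂_term_zero_two_mul (n : ℤ) (τ : ℂ) :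
    jacobiTheta₂_term n 0 (2 * τ) = cexp (2 * π * I * (n : ℂ) ^ 2 * τ) := by
  rw [jacobiTheta₂_term]; congr 1; ring

theorem summable_norm_thetaSeries {N : ℕ} [NeZero N] (F : ZMod N → ℂ) {τ : ℂ} (hτ : 0 < τ.im) :
    Summable fun x : ℤ => ‖F x * cexp (2 * π * I * (x : ℂ) ^ 2 * τ)‖ := by
  have h := ((summable_jacobiTheta₂_term_iff 0 (2 * τ)).2 (by simpa using hτ)).norm
  simp_rw [jacobiTheta₂_term_zero_two_mul] at h
  refine Summable.of_nonneg_of_le (fun _ => norm_nonneg _) (fun x => ?_) (h.mul_left (∑ k, ‖F k‖))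
  rw [norm_mul]
  gcongr
  exact Finset.single_le_sum (f := fun k => ‖F k‖) (fun _ _ => norm_nonneg _) (Finset.mem_univ _)

theorem hasSum_thetaSeries {N : ℕ} [NeZero N] (F : ZMod N → ℂ) {τ : ℂ} (hτ : 0 < τ.im) :
    HasSum (fun x : ℤ => F x * cexp (2 * π * I * (x : ℂ) ^ 2 * τ)) (thetaSeries F τ) :=
  (summable_norm_thetaSeries F hτ).of_norm.hasSum

theorem thetaSeries_comp_neg {N : ℕ} (F : ZMod N → ℂ) (τ : ℂ) :
    thetaSeries (fun k => F (-k)) τ = thetaSeries F τ := by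
  unfold thetaSeries
  rw [← (Equiv.neg ℤ).tsum_eq]
  simp

theorem thetaSeries_sum {N : ℕ} [NeZero N] {ι : Type*} (s : Finset ι) (c : ι → ℂ)
    (F : ι → ZMod N → ℂ) {τ : ℂ} (hτ : 0 < τ.im) :
    thetaSeries (fun k => ∑ i ∈ s, c i * F i k) τ = ∑ i ∈ s, c i * thetaSeries (F i) τ := by
  have h := hasSum_sum (s := s) fun i _ => (hasSum_thetaSeries (F i) hτ).mul_left (c i)
  rw [← h.tsum_eq]
  unfold thetaSeries
  refine tsum_congr fun x => ?_
  rw [Finset.sum_mul]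
  exact Finset.sum_congr rfl fun i _ => by ring

theorem thetaSeries_const_mul {N : ℕ} [NeZero N] (c : ℂ) (F : ZMod N → ℂ) (τ : ℂ) :
    thetaSeries (fun k => c * F k) τ = c * thetaSeries F τ := by
  unfold thetaSeries
  rw [← tsum_mul_left]
  exact tsum_congr fun x => by ring

/-- Put `x = qN + r`. Expanding `x²` leaves a Gaussian in `q` with parameter `2N²τ` and a linear
term `2Nrτ`. -/
theorem thetaSeries_eq_sum_jacobiTheta₂ {N : ℕ} [NeZero N] (F : ZMod N → ℂ) {τ : ℂ}
    (hτ : 0 < τ.im) :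
    thetaSeries F τ = ∑ r : ZMod N, F r * (cexp (2 * π * I * (r.val : ℂ) ^ 2 * τ) *
      jacobiTheta₂ (2 * N * r.val * τ) (2 * N ^ 2 * τ)) := by
  let e : ℤ ≃ ZMod N × ℤ := (Int.divModEquiv N).trans ((Equiv.prodComm _ _).trans
    ((ZMod.finEquiv N).toEquiv.prodCongr (Equiv.refl _)))
  have he : ∀ (r : ZMod N) (q : ℤ), e.symm (r, q) = q * N + r.val := by
    intro r q
    -- For a successor modulus `ZMod` reduces to `Fin`, and the formula becomes definitional.
    obtain ⟨n, rfl⟩ : ∃ n, N = n + 1 := ⟨N - 1, by have := NeZero.pos N; omega⟩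
    rfl
  have h := hasSum_thetaSeries F hτ
  rw [← e.symm.hasSum_iff] at h
  rw [← h.tsum_eq, h.summable.tsum_prod, tsum_fintype]
  refine Finset.sum_congr rfl fun r _ => ?_
  rw [jacobiTheta₂, ← tsum_mul_left, ← tsum_mul_left]
  refine tsum_congr fun q => ?_
  simp only [Function.comp_apply, he, jacobiTheta₂_term]
  rw [← Complex.exp_add]
  congr 1
  · simp
  · congr 1; push_cast; ring

/-- A weight `e(rx/N)` is a shift of the elliptic variable of Jacobi's function to `r/N`. The sign
in the Fourier kernel is immaterial because `x²` is even. -/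
theorem thetaSeries_dft {N : ℕ} [NeZero N] (F : ZMod N → ℂ) {τ : ℂ} (hτ : 0 < τ.im) :
    thetaSeries (ZMod.dft F) τ = ∑ r : ZMod N, F r * jacobiTheta₂ (r.val / N) (2 * τ) := by
  rw [← thetaSeries_comp_neg]
  have : (fun k => ZMod.dft F (-k)) =
      fun k => ∑ r : ZMod N, F r * (stdAddChar (r * k) : ℂ) := by
    ext k
    rw [dft_apply]
    exact Finset.sum_congr rfl fun r _ => by simp [mul_comm]
  rw [this, thetaSeries_sum _ _ _ hτ]
  refine Finset.sum_congr rfl fun r _ => ?_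
  rw [thetaSeries, jacobiTheta₂]
  congr 1
  refine tsum_congr fun x => ?_
  have : (r * (x : ZMod N)) = (((r.val : ℤ) * x : ℤ) : ZMod N) := by simp
  rw [this, stdAddChar_coe, jacobiTheta₂_term, ← Complex.exp_add]
  congr 1
  push_cast
  ring

/-! ### Principal square roots and Poisson summation -/

theorem neg_one_div_im_pos {τ : ℂ} (hτ : 0 < τ.im) : 0 < (-1 / τ).im := by
  have : τ ≠ 0 := fun h => by simp [h] at hτ
  rw [neg_div, one_div, neg_im, inv_im, neg_div, neg_neg]
  exact div_pos hτ (normSq_pos.2 this)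

theorem mul_cpow_of_arg_add_mem {x y : ℂ} (hx : x ≠ 0) (hy : y ≠ 0)
    (h : x.arg + y.arg ∈ Set.Ioc (-π) π) (s : ℂ) : (x * y) ^ s = x ^ s * y ^ s := by
  rw [cpow_def_of_ne_zero (mul_ne_zero hx hy), cpow_def_of_ne_zero hx, cpow_def_of_ne_zero hy,
    Complex.log_mul hx hy h, add_mul, Complex.exp_add]

theorem cpow_half_sq (z : ℂ) : (z ^ (1 / 2 : ℂ)) ^ 2 = z := by
  rw [← cpow_nat_mul]; norm_num

theorem cpow_half_ofReal {r : ℝ} (hr : 0 ≤ r) : (r : ℂ) ^ (1 / 2 : ℂ) = (√r : ℝ) := by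
  rw [Real.sqrt_eq_rpow, ofReal_cpow hr]; norm_num

theorem cpow_half_ofReal_mul {r : ℝ} (hr : 0 < r) (z : ℂ) :
    ((r : ℂ) * z) ^ (1 / 2 : ℂ) = (√r : ℝ) * z ^ (1 / 2 : ℂ) := by
  rcases eq_or_ne z 0 with rfl | hz
  · simp
  · rw [mul_cpow_of_arg_add_mem (by exact_mod_cast hr.ne') hz, cpow_half_ofReal hr.le]
    rw [arg_ofReal_of_nonneg hr.le, zero_add]
    exact ⟨neg_pi_lt_arg z, arg_le_pi z⟩

theorem abs_arg_lt_pi_div_two {z : ℂ} (h : 0 < z.re) : |z.arg| < π / 2 :=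
  abs_arg_lt_pi_div_two_iff.2 (Or.inl h)

/-- The arguments of `x` and `x * y` both lie in `(-π/2, π/2)`, so their difference is the argument
of `y` and no branch is crossed. -/
theorem cpow_half_mul_of_re_pos {x y : ℂ} (hx : 0 < x.re) (hxy : 0 < (x * y).re) :
    (x * y) ^ (1 / 2 : ℂ) = x ^ (1 / 2 : ℂ) * y ^ (1 / 2 : ℂ) := by
  have hx0 : x ≠ 0 := fun h => by simp [h] at hx
  have hy0 : y ≠ 0 := fun h => by simp [h] at hxy
  have h1 := abs_lt.1 (abs_arg_lt_pi_div_two hx)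
  have h2 := abs_lt.1 (abs_arg_lt_pi_div_two hxy)
  have h3 : x⁻¹.arg = -x.arg := by
    rw [arg_inv, if_neg]
    intro h; linarith [pi_pos]
  have h4 : y.arg = (x * y).arg - x.arg := by
    have := arg_mul (x := x * y) (y := x⁻¹) (mul_ne_zero hx0 hy0) (inv_ne_zero hx0)
      (by rw [h3]; constructor <;> linarith)
    rw [h3, mul_comm x y, mul_inv_cancel_right₀ hx0] at this
    rw [this, mul_comm]; ring
  refine mul_cpow_of_arg_add_mem hx0 hy0 ?_ _
  rw [h4]
  constructor <;> linarith

theorem cpow_half_neg_of_im_pos {z : ℂ} (h : 0 < z.im) :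
    (-z) ^ (1 / 2 : ℂ) = -I * z ^ (1 / 2 : ℂ) := by
  have hz : z ≠ 0 := fun h' => by simp [h'] at h
  rw [cpow_def_of_ne_zero (neg_ne_zero.2 hz), cpow_def_of_ne_zero hz, Complex.log, Complex.log,
    arg_neg_eq_arg_sub_pi_of_im_pos h, norm_neg]
  have : (-I : ℂ) = cexp (-(π / 2) * I) := by
    rw [neg_mul, Complex.exp_neg, Complex.exp_pi_div_two_mul_I]; simp
  rw [this, ← Complex.exp_add]
  congr 1; push_cast; ring

theorem cpow_half_neg_of_im_neg {z : ℂ} (h : z.im < 0) :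
    (-z) ^ (1 / 2 : ℂ) = I * z ^ (1 / 2 : ℂ) := by
  have := cpow_half_neg_of_im_pos (z := -z) (by simpa using h)
  rw [neg_neg] at this
  rw [this, ← mul_assoc]; simp

theorem div_two_I_re (τ : ℂ) : (τ / (2 * I)).re = τ.im / 2 := by
  rw [show τ / (2 * I) = ((1 / 2 : ℝ) : ℂ) * (-(I * τ)) by push_cast; field_simp; simp,
    re_ofReal_mul]
  simp; ring

theorem one_div_cpow_half_mul {N : ℕ} [NeZero N] {τ : ℂ} (hτ : 0 < τ.im) :
    1 / (-I * (2 * N ^ 2 * (-1 / τ))) ^ (1 / 2 : ℂ) = (τ / (2 * I)) ^ (1 / 2 : ℂ) / N := by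
  have h0 : τ ≠ 0 := fun h => by simp [h] at hτ
  have hN : (0 : ℝ) < N := by exact_mod_cast NeZero.pos N
  have h1 : -I * (2 * N ^ 2 * (-1 / τ)) = (((N : ℝ) ^ 2 : ℝ) : ℂ) * (τ / (2 * I))⁻¹ := by
    push_cast; field_simp
  have harg : (τ / (2 * I)).arg ≠ π := by
    intro h
    have := (arg_eq_pi_iff.1 h).1
    rw [div_two_I_re] at this
    linarith
  rw [h1, cpow_half_ofReal_mul (by positivity), inv_cpow _ _ harg, Real.sqrt_sq hN.le]
  simp [div_eq_mul_inv, mul_comm]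

/-- Poisson summation for `thetaSeries`. -/
theorem thetaSeries_neg_one_div {N : ℕ} [NeZero N] (F : ZMod N → ℂ) {τ : ℂ} (hτ : 0 < τ.im) :
    thetaSeries F (-1 / τ) = (τ / (2 * I)) ^ (1 / 2 : ℂ) / N *
      thetaSeries (ZMod.dft F) (τ / (4 * N ^ 2)) := by
  have h0 : τ ≠ 0 := fun h => by simp [h] at hτ
  have hN : (N : ℂ) ≠ 0 := NeZero.ne _
  have him : 0 < (τ / (4 * N ^ 2)).im := by
    rw [show τ / (4 * N ^ 2) = τ / ((4 * N ^ 2 : ℝ) : ℂ) by push_cast; rfl, div_ofReal_im]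
    have : (0 : ℝ) < N := by exact_mod_cast NeZero.pos N
    positivity
  rw [thetaSeries_eq_sum_jacobiTheta₂ F (neg_one_div_im_pos hτ), thetaSeries_dft F him,
    Finset.mul_sum]
  refine Finset.sum_congr rfl fun r _ => ?_
  rw [jacobiTheta₂_functional_equation, one_div_cpow_half_mul hτ]
  have h1 : 2 * (N : ℂ) * r.val * (-1 / τ) / (2 * N ^ 2 * (-1 / τ)) = r.val / N := by field_simp
  have h2 : -1 / (2 * (N : ℂ) ^ 2 * (-1 / τ)) = 2 * (τ / (4 * N ^ 2)) := by field_simp; norm_num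
  have h3 : cexp (2 * π * I * (r.val : ℂ) ^ 2 * (-1 / τ)) *
      cexp (-π * I * (2 * N * r.val * (-1 / τ)) ^ 2 / (2 * N ^ 2 * (-1 / τ))) = 1 := by
    rw [← Complex.exp_add, ← Complex.exp_zero]
    congr 1; field_simp; ring
  rw [h1, h2]
  linear_combination (F r * ((τ / (2 * I)) ^ (1 / 2 : ℂ) / N) *
    jacobiTheta₂ (r.val / N) (2 * (τ / (4 * N ^ 2)))) * h3

/-- Every weight is a Fourier transform, so the series is a finite combination of Jacobi functions
at fixed elliptic arguments. -/
theorem differentiableAt_thetaSeries {N : ℕ} [NeZero N] (F : ZMod N → ℂ) {τ : ℂ}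
    (hτ : 0 < τ.im) : DifferentiableAt ℂ (thetaSeries F) τ := by
  have h : thetaSeries F =ᶠ[𝓝 τ] fun z => ∑ r : ZMod N,
      (ZMod.dft.symm F) r * jacobiTheta₂ (r.val / N) (2 * z) := by
    filter_upwards [(isOpen_lt continuous_const continuous_im).mem_nhds hτ] with z hz
    rw [← thetaSeries_dft _ hz, LinearEquiv.apply_symm_apply]
  refine h.differentiableAt_iff.2 (DifferentiableAt.fun_sum fun r _ => ?_)
  refine (DifferentiableAt.comp τ (g := jacobiTheta₂ (r.val / N)) (f := fun z => 2 * z)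
    (differentiableAt_jacobiTheta₂_snd _ (by simpa using hτ)) (by fun_prop)).const_mul _

/-! ### Several variables: products of one-variable series -/

theorem hasSum_prod_pi {ι : Type*} {d : ℕ} (g : Fin d → ι → ℂ)
    (hg : ∀ i, Summable fun n => ‖g i n‖) :
    (Summable fun x : Fin d → ι => ‖∏ i, g i (x i)‖) ∧
      HasSum (fun x : Fin d → ι => ∏ i, g i (x i)) (∏ i, ∑' n, g i n) := by
  induction d with
  | zero => exact ⟨(hasSum_unique _).summable, by simp⟩
  | succ d ih =>
    obtain ⟨h1, h2⟩ := ih (fun i => g i.succ) (fun i => hg i.succ)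
    have hs : Summable fun x : Fin (d + 1) → ι => ‖∏ i, g i (x i)‖ := by
      rw [← (Fin.consEquiv fun _ : Fin (d + 1) => ι).summable_iff]
      refine ((hg 0).mul_norm h1).congr fun x => ?_
      simp [Fin.consEquiv, Fin.prod_univ_succ]
    refine ⟨hs, ?_⟩
    rw [← (Fin.consEquiv fun _ : Fin (d + 1) => ι).hasSum_iff, Fin.prod_univ_succ]
    rw [← h2.tsum_eq, tsum_mul_tsum_of_summable_norm (hg 0) h1]
    convert! (summable_mul_of_summable_norm (hg 0) h1).hasSum using 2 with x
    simp [Fin.consEquiv, Fin.prod_univ_succ]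

theorem exp_sum_sq {d : ℕ} (x : Fin d → ℤ) (τ : ℂ) :
    cexp (2 * π * I * ((∑ i, x i * x i : ℤ) : ℂ) * τ) =
      ∏ i, cexp (2 * π * I * (x i : ℂ) ^ 2 * τ) := by
  rw [← Complex.exp_sum]
  congr 1
  push_cast
  rw [Finset.mul_sum, Finset.sum_mul]
  exact Finset.sum_congr rfl fun i _ => by ring

theorem hasSum_prod_thetaSeries {N d : ℕ} [NeZero N] (F : Fin d → ZMod N → ℂ) (τ : ℍ) :
    HasSum (fun x : Fin d → ℤ => (∏ i, F i (x i)) *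
      cexp (2 * π * I * ((∑ i, x i * x i : ℤ) : ℂ) * τ)) (∏ i, thetaSeries (F i) τ) := by
  have h := (hasSum_prod_pi (fun i (x : ℤ) => F i x * cexp (2 * π * I * (x : ℂ) ^ 2 * τ))
    fun i => summable_norm_thetaSeries (F i) τ.2).2
  simpa only [exp_sum_sq, Finset.prod_mul_distrib, thetaSeries] using h

/-- A weight on `(ℤ/Nℤ)^d` is a combination of indicators of points, and each indicator is a product
over the coordinates. This carries every one-variable identity over to `theta`. -/
theorem hasSum_sum_prod_thetaSeries {N d : ℕ} [NeZero N] (F : (Fin d → ZMod N) → ℂ) (τ : ℍ) :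
    HasSum (fun x : Fin d → ℤ => F (fun i => (x i : ZMod N)) *
      cexp (2 * π * I * ((∑ i, x i * x i : ℤ) : ℂ) * τ))
      (∑ h, F h * ∏ i, thetaSeries (Pi.single (h i) 1) τ) := by
  have h := hasSum_sum (s := Finset.univ) fun (h : Fin d → ZMod N) _ =>
    (hasSum_prod_thetaSeries (fun i => Pi.single (h i) 1) τ).mul_left (F h)
  refine h.congr_fun fun x => ?_
  rw [Finset.sum_eq_single (fun i => (x i : ZMod N))]
  · simp
  · intro k _ hk
    obtain ⟨i, hi⟩ : ∃ i, k i ≠ x i := by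
      by_contra! h'
      exact hk (funext h')
    rw [Finset.prod_eq_zero (Finset.mem_univ i) (Pi.single_eq_of_ne hi.symm _)]
    simp
  · simp

theorem theta_eq_sum_prod {N d : ℕ} [NeZero N] (F : (Fin d → ZMod N) → ℂ) (τ : ℍ) :
    theta F τ = ∑ h, F h * ∏ i, thetaSeries (Pi.single (h i) 1) τ :=
  (hasSum_sum_prod_thetaSeries F τ).tsum_eq

theorem hasSum_theta {N d : ℕ} [NeZero N] (F : (Fin d → ZMod N) → ℂ) (τ : ℍ) :
    HasSum (fun x : Fin d → ℤ => F (fun i => (x i : ZMod N)) *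
      cexp (2 * π * I * ((∑ i, x i * x i : ℤ) : ℂ) * τ)) (theta F τ) := by
  rw [theta_eq_sum_prod]
  exact hasSum_sum_prod_thetaSeries F τ

theorem mdifferentiable_theta {N d : ℕ} [NeZero N] (F : (Fin d → ZMod N) → ℂ) :
    MDifferentiable 𝓘(ℂ) 𝓘(ℂ) (theta F) := by
  rw [UpperHalfPlane.mdifferentiable_iff]
  have h : DifferentiableOn ℂ (fun τ : ℂ => ∑ h : Fin d → ZMod N,
      F h * ∏ i, thetaSeries (Pi.single (h i) 1) τ) {z | 0 < z.im} := by
    intro z hz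
    refine (DifferentiableAt.fun_sum fun h _ => DifferentiableAt.const_mul
      (DifferentiableAt.fun_finsetProd fun i _ => ?_) _).differentiableWithinAt
    exact differentiableAt_thetaSeries _ hz
  refine h.congr fun z hz => ?_
  simp only [Function.comp_apply, theta_eq_sum_prod, UpperHalfPlane.ofComplex_apply_of_im_pos hz]

/-- The Fourier transform on `(ℤ/Nℤ)^d`. -/
def dftPi {N d : ℕ} [NeZero N] (F : (Fin d → ZMod N) → ℂ) (k : Fin d → ZMod N) : ℂ :=
  ∑ h, F h * ∏ i, stdAddChar (-(h i * k i))

theorem dftPi_zero {N d : ℕ} [NeZero N] (F : (Fin d → ZMod N) → ℂ) :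
    dftPi F (fun _ => 0) = ∑ h, F h := by
  simp [dftPi]

/-- Poisson summation for `theta`. -/
theorem theta_neg_one_div {N d : ℕ} [NeZero N] (F : (Fin d → ZMod N) → ℂ) {τ σ ρ : ℍ}
    (hσ : (σ : ℂ) = -1 / τ) (hρ : (ρ : ℂ) = τ / (4 * N ^ 2)) :
    theta F σ = (((τ : ℂ) / (2 * I)) ^ (1 / 2 : ℂ) / N) ^ d * theta (dftPi F) ρ := by
  have key : ∀ r : ZMod N, thetaSeries (ZMod.dft (Pi.single r (1 : ℂ))) (ρ : ℂ) =
      ∑ k : ZMod N, stdAddChar (-(r * k)) * thetaSeries (Pi.single k 1) (ρ : ℂ) := by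
    intro r
    rw [← thetaSeries_sum _ _ _ ρ.2]
    congr 1
    ext k
    rw [dft_apply, Finset.sum_eq_single r, Finset.sum_eq_single k]
    · simp
    · intro b _ hb; simp [hb.symm]
    · simp
    · intro b _ hb; simp [hb]
    · simp
  simp_rw [theta_eq_sum_prod, hσ, thetaSeries_neg_one_div _ τ.2, ← hρ, key,
    Finset.prod_mul_distrib, Finset.prod_const, Finset.card_univ, Fintype.card_fin,
    Finset.prod_univ_sum, Fintype.piFinset_univ, dftPi, Finset.sum_mul, Finset.mul_sum]
  rw [Finset.sum_comm]
  refine Finset.sum_congr rfl fun k _ => Finset.sum_congr rfl fun h _ => ?_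
  rw [Finset.prod_mul_distrib]
  ring

theorem stdAddChar_intCast_div {M : ℕ} [NeZero M] (A n : ℤ) :
    (stdAddChar ((A : ZMod M) * (n : ZMod M)) : ℂ) = cexp (2 * π * I * n * (A / M)) := by
  rw [← Int.cast_mul, stdAddChar_coe]
  congr 1
  push_cast
  ring

/-- Since `x²` is an integer, `e(x² A/M)` depends only on `x` mod `M`, so a rational translation
only changes the weight. -/
theorem thetaSeries_add {p M : ℕ} (h : p ∣ M) [NeZero M] (F : ZMod p → ℂ) (A : ℤ) (v : ℂ) :
    thetaSeries F (A / M + v) = thetaSeries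
      (fun x : ZMod M => F (castHom h (ZMod p) x) * stdAddChar ((A : ZMod M) * x ^ 2)) v := by
  unfold thetaSeries
  refine tsum_congr fun x => ?_
  have := stdAddChar_intCast_div (M := M) A (x ^ 2)
  push_cast at this
  beta_reduce
  rw [this, map_intCast, mul_add, Complex.exp_add]
  ring

theorem theta_add {p M d : ℕ} (h : p ∣ M) [NeZero M] (F : (Fin d → ZMod p) → ℂ) (A : ℤ)
    {τ σ : ℍ} (hσ : (σ : ℂ) = A / M + τ) :
    theta F σ = theta (fun x : Fin d → ZMod M => F (fun i => castHom h (ZMod p) (x i)) *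
      stdAddChar ((A : ZMod M) * ∑ i, x i * x i)) τ := by
  unfold theta
  refine tsum_congr fun x => ?_
  have := stdAddChar_intCast_div (M := M) A (∑ i, x i * x i)
  push_cast at this
  simp only [map_intCast]
  rw [this, hσ, mul_add, Complex.exp_add]
  push_cast
  ring

/-! ### Fourier expansion and the limit at the cusp `∞` -/

/-- The sum of `F` over the integral vectors of square norm `n`. -/
def normCoeff {N d : ℕ} (F : (Fin d → ZMod N) → ℂ) (n : ℕ) : ℂ :=
  ∑' x : {x : Fin d → ℤ // (∑ i, x i * x i).toNat = n}, F (fun i => (x.1 i : ZMod N))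

theorem normCoeff_zero {N d : ℕ} (F : (Fin d → ZMod N) → ℂ) :
    normCoeff F 0 = F (fun _ => 0) := by
  have h : ∀ x : Fin d → ℤ, (∑ i, x i * x i).toNat = 0 ↔ x = 0 := by
    intro x
    rw [Int.toNat_eq_zero, (Finset.sum_nonneg fun i _ => mul_self_nonneg (x i)).ge_iff_eq',
      Finset.sum_eq_zero_iff_of_nonneg fun i _ => mul_self_nonneg (x i), funext_iff]
    simp
  have : Unique {x : Fin d → ℤ // (∑ i, x i * x i).toNat = 0} :=
    { default := ⟨0, (h 0).2 rfl⟩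
      uniq := fun x => Subtype.ext ((h x.1).1 x.2) }
  have h0 : (default : {x : Fin d → ℤ // (∑ i, x i * x i).toNat = 0}).1 = 0 :=
    (h _).1 (default : {x : Fin d → ℤ // (∑ i, x i * x i).toNat = 0}).2
  rw [normCoeff, tsum_fintype, Fintype.sum_unique, h0]
  simp

theorem hasSum_theta_normCoeff {N d : ℕ} [NeZero N] (F : (Fin d → ZMod N) → ℂ) (τ : ℍ) :
    HasSum (fun n : ℕ => normCoeff F n * cexp (2 * π * I * τ) ^ n) (theta F τ) := by
  have h := hasSum_theta F τ
  rw [← (Equiv.sigmaFiberEquiv fun x : Fin d → ℤ => (∑ i, x i * x i).toNat).hasSum_iff] at h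
  have h2 := h.sigma fun n => (h.summable.sigma_factor n).hasSum
  refine h2.congr_fun fun n => ?_
  rw [normCoeff, ← tsum_mul_right]
  refine tsum_congr fun x => ?_
  have hx := x.2
  have hx' : (∑ i, x.1 i * x.1 i) = (n : ℤ) := by
    have := Int.toNat_of_nonneg (Finset.sum_nonneg fun i (_ : i ∈ Finset.univ) =>
      mul_self_nonneg (x.1 i))
    omega
  simp only [Function.comp_apply, Equiv.sigmaFiberEquiv, Equiv.coe_fn_mk]
  rw [hx', ← Complex.exp_nat_mul]
  congr 2
  push_cast; ring

theorem HasFourierExpansion.tendsto {ψ : ℍ → ℂ} {m : ℕ} {a : ℕ → ℂ}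
    (h : HasFourierExpansion ψ m a) (hm : 0 < m) :
    Tendsto ψ UpperHalfPlane.atImInfty (𝓝 (a 0)) := by
  have hm' : (0 : ℝ) < m := by exact_mod_cast hm
  have h1 : ψ = fun τ : ℍ => ∑' n, a n * Function.Periodic.qParam m τ ^ n := by
    ext τ
    rw [← (h τ).tsum_eq]
    simp [Function.Periodic.qParam]
  have h2 : a 0 = ∑' n : ℕ, if n = 0 then a 0 else 0 := by simp
  rw [h1, h2]
  -- The terms at `τ = i` dominate those at every `τ` with imaginary part at least 1.
  have hb := (h UpperHalfPlane.I).summable.norm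
  refine tendsto_tsum_of_dominated_convergence hb (fun n => ?_) ?_
  · have hq := UpperHalfPlane.qParam_tendsto_atImInfty hm'
    have := (hq.pow n).const_mul (a n)
    rcases eq_or_ne n 0 with rfl | hn
    · simp
    · simpa [hn] using this
  · filter_upwards [(UpperHalfPlane.atImInfty_mem {τ : ℍ | 1 ≤ τ.im}).2 ⟨1, fun z hz => hz⟩]
      with τ hτ n
    have hle : ‖Function.Periodic.qParam m τ‖ ≤ ‖Function.Periodic.qParam m UpperHalfPlane.I‖ := by
      rw [Function.Periodic.norm_qParam, Function.Periodic.norm_qParam]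
      have h4 : (1 : ℝ) ≤ (τ : ℂ).im := hτ
      have h5 : ((UpperHalfPlane.I : ℍ) : ℂ).im = 1 := by simp
      rw [h5, Real.exp_le_exp]
      refine div_le_div_of_nonneg_right ?_ hm'.le
      nlinarith [pi_pos]
    have h3 : cexp (2 * π * Complex.I * (UpperHalfPlane.I : ℍ) / m) =
        Function.Periodic.qParam m (UpperHalfPlane.I : ℍ) := by
      simp [Function.Periodic.qParam]
    rw [h3, norm_mul, norm_mul, norm_pow, norm_pow]
    gcongr

theorem hasFourierExpansion_theta {N d : ℕ} [NeZero N] (F : (Fin d → ZMod N) → ℂ) :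
    HasFourierExpansion (theta F) 1 (normCoeff F) := by
  intro τ
  simpa using hasSum_theta_normCoeff F τ

theorem tendsto_theta {N d : ℕ} [NeZero N] (F : (Fin d → ZMod N) → ℂ) :
    Tendsto (theta F) UpperHalfPlane.atImInfty (𝓝 (F fun _ => 0)) := by
  rw [← normCoeff_zero F]
  exact (hasFourierExpansion_theta F).tendsto one_pos

theorem thetaSeries_eq_theta {N : ℕ} (F : ZMod N → ℂ) (τ : ℍ) :
    thetaSeries F τ = theta (fun x : Fin 1 → ZMod N => F (x 0)) τ := by
  rw [thetaSeries, theta, ← (Equiv.funUnique (Fin 1) ℤ).tsum_eq]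
  refine tsum_congr fun x => ?_
  simp [sq]

theorem tendsto_thetaSeries {N : ℕ} [NeZero N] (F : ZMod N → ℂ) {ι : Type*} {l : Filter ι}
    {g : ι → ℂ} (hg : Tendsto (fun i => (g i).im) l atTop) :
    Tendsto (fun i => thetaSeries F (g i)) l (𝓝 (F 0)) := by
  have h1 : Tendsto (fun i => UpperHalfPlane.ofComplex (g i)) l UpperHalfPlane.atImInfty := by
    rw [UpperHalfPlane.atImInfty, tendsto_comap_iff]
    refine hg.congr' ?_
    filter_upwards [hg.eventually_gt_atTop 0] with i hi
    simp [UpperHalfPlane.ofComplex_apply_of_im_pos hi]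
  refine ((tendsto_theta fun x : Fin 1 → ZMod N => F (x 0)).comp h1).congr' ?_
  filter_upwards [hg.eventually_gt_atTop 0] with i hi
  simp only [Function.comp_apply, ← thetaSeries_eq_theta]
  rw [UpperHalfPlane.ofComplex_apply_of_im_pos hi]

/-! ### Quadratic Gauss sums -/

/-- The quadratic Gauss sum `∑_{j mod D} e(b j² / D)`. -/
def quadGauss (D : ℕ) [NeZero D] (b : ℤ) : ℂ :=
  ∑ j : ZMod D, stdAddChar ((b : ZMod D) * j ^ 2)

theorem quadGauss_congr {D : ℕ} [NeZero D] {b b' : ℤ} (h : (b : ZMod D) = b') :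
    quadGauss D b = quadGauss D b' := by
  unfold quadGauss; rw [h]

/-- The partial fraction `1/(ND) = u/N + v/D`. -/
theorem stdAddChar_mul_eq {N D : ℕ} [NeZero N] [NeZero D] {u v : ℤ} (h : D * u + N * v = 1)
    (x : ZMod (N * D)) :
    (stdAddChar x : ℂ) =
      stdAddChar ((u : ZMod N) * castHom (Dvd.intro _ rfl) (ZMod N) x) *
        stdAddChar ((v : ZMod D) * castHom (Dvd.intro_left _ rfl) (ZMod D) x) := by
  obtain ⟨x, rfl⟩ := ZMod.intCast_surjective x
  simp only [map_intCast]
  rw [← Int.cast_mul, ← Int.cast_mul, stdAddChar_coe, stdAddChar_coe,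
    stdAddChar_coe, ← Complex.exp_add]
  congr 1
  have hN : (N : ℂ) ≠ 0 := NeZero.ne _
  have hD : (D : ℂ) ≠ 0 := NeZero.ne _
  have h' : (D : ℂ) * u + N * v = 1 := by exact_mod_cast h
  push_cast
  field_simp
  linear_combination -(x : ℂ) * h'

theorem sum_mul_castHom {N D : ℕ} [NeZero N] [NeZero D] (h : N.Coprime D) (f : ZMod N → ℂ)
    (g : ZMod D → ℂ) :
    ∑ r : ZMod (N * D), f (castHom (Dvd.intro _ rfl) (ZMod N) r) *
      g (castHom (Dvd.intro_left _ rfl) (ZMod D) r) = (∑ i, f i) * ∑ j, g j := by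
  rw [Finset.sum_mul_sum, ← Finset.sum_product', Finset.univ_product_univ,
    ← (ZMod.chineseRemainder h).toEquiv.sum_comp]
  refine Finset.sum_congr rfl fun r _ => ?_
  obtain ⟨r, rfl⟩ := ZMod.intCast_surjective r
  simp

theorem quadGauss_mul_sq {D : ℕ} [NeZero D] {u : ℤ} (hu : IsCoprime u D) (b : ℤ) :
    quadGauss D (b * u ^ 2) = quadGauss D b := by
  have hu' : IsUnit (u : ZMod D) := by
    obtain ⟨x, y, h⟩ := hu
    have := congrArg (Int.cast : ℤ → ZMod D) h
    push_cast at this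
    rw [natCast_self, mul_zero, add_zero, mul_comm] at this
    exact IsUnit.of_mul_eq_one _ this
  unfold quadGauss
  rw [← Equiv.sum_comp (Units.mulLeft hu'.unit) fun j => stdAddChar ((b : ZMod D) * j ^ 2)]
  refine Finset.sum_congr rfl fun j _ => ?_
  congr 1
  simp
  ring

/-- The Chinese remainder theorem splits the sum mod `bD` into sums with coefficients `v = D⁻¹` mod
`b` and `u = b⁻¹` mod `D`. Multiplying these by the squares `D²` and `b²` changes neither sum and
turns the inverses into `D` and `b`. -/
theorem quadGauss_mul_quadGauss {b D : ℕ} [NeZero b] [NeZero D] (h : b.Coprime D) :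
    quadGauss b D * quadGauss D b = quadGauss (b * D) 1 := by
  obtain ⟨u, v, huv⟩ := Nat.isCoprime_iff_coprime.2 h
  have h1 : (D : ℤ) * v + b * u = 1 := by linarith
  have e : quadGauss (b * D) 1 = quadGauss b v * quadGauss D u := by
    unfold quadGauss
    rw [← sum_mul_castHom h]
    refine Finset.sum_congr rfl fun r _ => ?_
    rw [stdAddChar_mul_eq h1]
    simp
  rw [e, ← quadGauss_mul_sq (u := D) (D := b) (b := v) ⟨v, u, by linarith⟩,
    ← quadGauss_mul_sq (u := b) (D := D) (b := u) ⟨u, v, by linarith⟩]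
  have c1 : (D : ZMod b) * v = 1 := by
    have := congrArg (Int.cast : ℤ → ZMod b) h1
    simpa using this
  have c2 : (b : ZMod D) * u = 1 := by
    have := congrArg (Int.cast : ℤ → ZMod D) h1
    simpa using this
  congr 1
  · apply quadGauss_congr; push_cast; linear_combination -(D : ZMod b) * c1
  · apply quadGauss_congr; push_cast; linear_combination -(b : ZMod D) * c2

theorem sum_stdAddChar_four (n : ℤ) :
    ∑ x : ZMod 4, (stdAddChar ((n : ZMod 4) * x ^ 2) : ℂ) = 2 + 2 * stdAddChar (n : ZMod 4) := by
  have h : ∀ f : ZMod 4 → ℂ, ∑ x, f x = f 0 + f 1 + f 2 + f 3 := fun f => Fin.sum_univ_four f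
  have h4 : (2 : ZMod 4) ^ 2 = 0 := by decide
  have h9 : (3 : ZMod 4) ^ 2 = 1 := by decide
  rw [h, h4, h9]
  simp
  ring

theorem stdAddChar_four_one : (stdAddChar (1 : ZMod 4) : ℂ) = I := by
  have := stdAddChar_coe (N := 4) 1
  rw [Int.cast_one] at this
  rw [this]
  refine Eq.trans ?_ Complex.exp_pi_div_two_mul_I
  congr 1
  push_cast
  ring

theorem cpow_half_I_div_two : (I / 2) ^ (1 / 2 : ℂ) = (1 + I) / 2 := by
  have h : I / 2 = ((1 + I) / 2) ^ 2 := by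
    rw [div_pow, add_sq, I_sq]; ring
  rw [h, one_div, sq_cpow_two_inv (by simp)]

/-- A limiting case of the Landsberg–Schaar relation. -/
theorem quadGauss_one_eq_sum (D : ℕ) [NeZero D] :
    quadGauss D 1 = √D * ((1 + I) / 2) * (1 + stdAddChar ((-D : ℤ) : ZMod 4)) := by
  have hD : (0 : ℝ) < D := by exact_mod_cast NeZero.pos D
  have hD0 : (D : ℂ) ≠ 0 := NeZero.ne _
  set F₁ : ZMod D → ℂ := fun x => stdAddChar (((1 : ℤ) : ZMod D) * x ^ 2) with hF₁
  set F₂ : ZMod 4 → ℂ := fun x => stdAddChar (((-D : ℤ) : ZMod 4) * x ^ 2) with hF₂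
  -- With `τ = 2iy`, these are `w = τ₂/(2iy)` and `z = Z/(2i)` for the points `τ₂`, `Z` below. Their
  -- limits `4/D²` and `iD/2` avoid the branch cut.
  let w : ℝ → ℂ := fun y => ((4 / (D : ℝ) ^ 2 : ℝ) : ℂ) * (1 + I * (D : ℂ) / 2 * (y⁻¹ : ℝ))
  let z : ℝ → ℂ := fun y => -(D : ℂ) / (2 * I - D * (y⁻¹ : ℝ))
  -- The unweighted theta value at `1/D - 1/τ = -1/Z` is computed twice: by Poisson summation mod
  -- `D`, and by Poisson summation mod 1 followed by one mod 4 at `Z/4 = -D/4 - 1/τ₂`. Letting `y →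
  -- ∞` compares the constant terms.
  have key : ∀ᶠ y : ℝ in atTop, thetaSeries (ZMod.dft F₁) (2 * I * y / (4 * D ^ 2)) / D =
      z y ^ (1 / 2 : ℂ) * (w y ^ (1 / 2 : ℂ) / 4) *
        thetaSeries (ZMod.dft F₂) (2 * I * (y * w y) / (4 * (4 : ℕ) ^ 2)) := by
    filter_upwards [eventually_gt_atTop 0] with y hy
    have hy0 : (y : ℂ) ≠ 0 := by exact_mod_cast hy.ne'
    have hsq : ((√y : ℝ) : ℂ) ≠ 0 := by exact_mod_cast (Real.sqrt_pos.2 hy).ne'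
    have hden : (2 * I * y - D : ℂ) ≠ 0 := fun h => by
      have := congrArg im h
      simp at this
      exact hy.ne' this
    let τ : ℂ := 2 * I * y
    have hτ : 0 < τ.im := by simpa [τ] using hy
    have hτ0 : τ ≠ 0 := fun h => by simp [h] at hτ
    have hτ1 : τ / (2 * I) = (y : ℂ) * 1 := by simp only [τ]; field_simp
    let Z : ℂ := 2 * I * z y
    have hzy : z y = -(D * y) / (2 * I * y - D) := by
      have : (2 * I - D * (y⁻¹ : ℝ) : ℂ) ≠ 0 := by
        push_cast
        rw [show (2 * I - D * (y : ℂ)⁻¹) = (2 * I * y - D) / y by field_simp]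
        exact div_ne_zero hden hy0
      rw [div_eq_div_iff this hden]
      push_cast
      field_simp
    have hZ : ((1 : ℤ) : ℂ) / D + -1 / τ = -1 / Z := by
      simp only [Z, hzy, τ]
      push_cast
      field_simp
      ring
    have hZ' : Z = -1 / (((1 : ℤ) : ℂ) / D + -1 / τ) := by
      rw [hZ]; simp
    have hZim : 0 < Z.im := by
      rw [hZ']
      refine neg_one_div_im_pos ?_
      have : (((1 : ℤ) : ℂ) / D).im = 0 := by simp
      rw [add_im, this, zero_add]
      exact neg_one_div_im_pos hτ
    let τ₂ : ℂ := 2 * I * (y * w y)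
    have hτ₂e : τ₂ = 4 * (τ - D) / D ^ 2 := by
      simp only [τ₂, w, τ]
      push_cast
      field_simp
      linear_combination (D : ℂ) * I_sq
    have hτ₂ : 0 < τ₂.im := by
      rw [hτ₂e, show 4 * (τ - D) / (D : ℂ) ^ 2 = ((4 / (D : ℝ) ^ 2 : ℝ) : ℂ) * (τ - D) by
        push_cast; ring, im_ofReal_mul, sub_im, natCast_im, sub_zero]
      positivity
    have hZ4 : Z / (4 * (1 : ℕ) ^ 2) = ((-D : ℤ) : ℂ) / (4 : ℕ) + -1 / τ₂ := by
      have : τ - D ≠ 0 := hden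
      rw [hτ₂e]
      simp only [Z, hzy]
      push_cast
      rw [show 2 * I * (-(D * y) / (2 * I * y - D)) = -D * τ / (τ - D) by simp only [τ]; ring]
      field_simp
      ring
    have e1 : thetaSeries F₁ (-1 / τ) = thetaSeries (fun _ : ZMod 1 => 1) (-1 / Z) := by
      rw [← hZ, thetaSeries_add (one_dvd D)]
      simp [hF₁]
    have e2 : thetaSeries (ZMod.dft fun _ : ZMod 1 => (1 : ℂ)) (Z / (4 * (1 : ℕ) ^ 2)) =
        thetaSeries F₂ (-1 / τ₂) := by
      have : ZMod.dft (fun _ : ZMod 1 => (1 : ℂ)) = fun _ => 1 := by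
        ext k
        rw [dft_apply, Subsingleton.elim k 0]
        simp
      rw [hZ4, this, thetaSeries_add (one_dvd 4)]
      simp [hF₂]
    rw [thetaSeries_neg_one_div _ hτ, thetaSeries_neg_one_div _ hZim, e2,
      thetaSeries_neg_one_div _ hτ₂, hτ1, cpow_half_ofReal_mul hy,
      show Z / (2 * I) = z y by simp only [Z]; field_simp,
      show τ₂ / (2 * I) = y * w y by simp only [τ₂]; field_simp, cpow_half_ofReal_mul hy,
      one_cpow] at e1
    apply mul_left_cancel₀ hsq
    simp only [τ, τ₂, Nat.cast_one, div_one, mul_one] at e1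
    linear_combination e1
  have hinv : Tendsto (fun y : ℝ => ((y⁻¹ : ℝ) : ℂ)) atTop (𝓝 0) := by
    have := (continuous_ofReal.tendsto 0).comp tendsto_inv_atTop_zero
    simpa [Function.comp_def] using this
  have hw : Tendsto w atTop (𝓝 ((4 / (D : ℝ) ^ 2 : ℝ) : ℂ)) := by
    have := ((hinv.const_mul (I * (D : ℂ) / 2)).const_add 1).const_mul ((4 / (D : ℝ) ^ 2 : ℝ) : ℂ)
    simpa only [mul_zero, add_zero, mul_one] using this
  have hz : Tendsto z atTop (𝓝 ((D : ℝ) * (I / 2))) := by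
    have h2 : (2 * I - D * 0 : ℂ) ≠ 0 := by simp
    have := Tendsto.div (tendsto_const_nhds (x := -(D : ℂ))) ((hinv.const_mul (D : ℂ)).const_sub (2 * I)) h2
    convert! this using 2
    field_simp
    linear_combination (2 * (D : ℂ)) * I_sq
  have hw' : Tendsto (fun y => w y ^ (1 / 2 : ℂ)) atTop (𝓝 (2 / D)) := by
    have h1 : (2 / D : ℂ) = ((4 / (D : ℝ) ^ 2 : ℝ) : ℂ) ^ (1 / 2 : ℂ) := by
      rw [cpow_half_ofReal (by positivity), show (4 / (D : ℝ) ^ 2) = (2 / D) ^ 2 by ring,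
        Real.sqrt_sq (by positivity)]
      push_cast; rfl
    rw [h1]
    exact hw.cpow tendsto_const_nhds (ofReal_mem_slitPlane.2 (by positivity))
  have hz' : Tendsto (fun y => z y ^ (1 / 2 : ℂ)) atTop (𝓝 (√D * ((1 + I) / 2))) := by
    have h1 : (√D * ((1 + I) / 2) : ℂ) = ((D : ℝ) * (I / 2)) ^ (1 / 2 : ℂ) := by
      rw [cpow_half_ofReal_mul hD, cpow_half_I_div_two]
    rw [h1]
    refine hz.cpow tendsto_const_nhds (Or.inr ?_)
    simpa using NeZero.ne D
  have h1 : Tendsto (fun y : ℝ => thetaSeries (ZMod.dft F₁) (2 * I * y / (4 * D ^ 2)) / D) atTop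
      (𝓝 (quadGauss D 1 / D)) := by
    have e : quadGauss D 1 = ZMod.dft F₁ 0 := by rw [dft_apply_zero]; rfl
    rw [e]
    refine (tendsto_thetaSeries _ ?_).div_const _
    have : ∀ y : ℝ, (2 * I * y / (4 * D ^ 2) : ℂ).im = y * (1 / (2 * (D : ℝ) ^ 2)) := by
      intro y
      rw [show (2 * I * y / (4 * D ^ 2) : ℂ) = ((y * (1 / (2 * (D : ℝ) ^ 2)) : ℝ) : ℂ) * I by
        push_cast; field_simp; ring, im_ofReal_mul]
      simp
    simp_rw [this]
    exact tendsto_id.atTop_mul_const (by positivity)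
  have h2 : Tendsto (fun y : ℝ =>
      thetaSeries (ZMod.dft F₂) (2 * I * (y * w y) / (4 * (4 : ℕ) ^ 2))) atTop
      (𝓝 (2 + 2 * stdAddChar ((-D : ℤ) : ZMod 4))) := by
    rw [← sum_stdAddChar_four, show ∑ x : ZMod 4, (stdAddChar (((-D : ℤ) : ZMod 4) * x ^ 2) : ℂ)
      = ZMod.dft F₂ 0 by rw [dft_apply_zero]]
    refine tendsto_thetaSeries _ ?_
    have : ∀ᶠ y : ℝ in atTop, (2 * I * (y * w y) / (4 * (4 : ℕ) ^ 2) : ℂ).im =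
        y * (1 / (8 * (D : ℝ) ^ 2)) := by
      filter_upwards [eventually_gt_atTop 0] with y hy
      have hy' : (y : ℂ) ≠ 0 := by exact_mod_cast hy.ne'
      rw [show (2 * I * (y * w y) / (4 * (4 : ℕ) ^ 2) : ℂ) =
        ((y * (1 / (8 * (D : ℝ) ^ 2)) : ℝ) : ℂ) * I + ((-(1 / (16 * (D : ℝ))) : ℝ) : ℂ) by
        simp only [w]; push_cast; field_simp; ring_nf; rw [I_sq]; ring, add_im, ofReal_im,
        im_ofReal_mul]
      simp
    refine Tendsto.congr' (this.mono fun y hy => hy.symm) ?_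
    exact tendsto_id.atTop_mul_const (by positivity)
  have h3 := tendsto_nhds_unique (h1.congr' key) ((hz'.mul (hw'.div_const 4)).mul h2)
  field_simp at h3
  linear_combination h3 / 4

theorem eps_natCast_of_mod_four_eq_one {D : ℕ} (h : D % 4 = 1) : eps D = 1 := by
  rw [eps, if_pos (by omega)]

theorem eps_natCast_of_mod_four_eq_three {D : ℕ} (h : D % 4 = 3) : eps D = I := by
  rw [eps, if_neg (by omega)]

theorem quadGauss_one {D : ℕ} [NeZero D] (hD : Odd D) : quadGauss D 1 = eps D * √D := by
  rw [quadGauss_one_eq_sum]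
  have hI := I_sq
  rcases Nat.odd_mod_four_iff.1 (Nat.odd_iff.1 hD) with h | h
  · have h4 : ((-D : ℤ) : ZMod 4) = -1 := by
      rw [show (-1 : ZMod 4) = ((-1 : ℤ) : ZMod 4) by simp, ZMod.intCast_eq_intCast_iff_dvd_sub]
      omega
    rw [h4, eps_natCast_of_mod_four_eq_one h, AddChar.map_neg_eq_inv, stdAddChar_four_one, inv_I]
    linear_combination -(√D / 2 : ℂ) * hI
  · have h4 : ((-D : ℤ) : ZMod 4) = 1 := by
      rw [show (1 : ZMod 4) = ((1 : ℤ) : ZMod 4) by simp, ZMod.intCast_eq_intCast_iff_dvd_sub]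
      omega
    rw [h4, eps_natCast_of_mod_four_eq_three h, stdAddChar_four_one]
    linear_combination (√D / 2 : ℂ) * hI

theorem quadGauss_neg {D : ℕ} [NeZero D] (b : ℤ) :
    quadGauss D (-b) = (starRingEnd ℂ) (quadGauss D b) := by
  unfold quadGauss
  rw [map_sum]
  refine Finset.sum_congr rfl fun j _ => ?_
  rw [← AddChar.map_neg_eq_conj]
  congr 1
  push_cast
  ring

/-- The sign of the quadratic Gauss sum for odd moduli. -/
theorem quadGauss_eq {D : ℕ} [hNZ : NeZero D] (hD : Odd D) {b : ℤ} (hb : IsCoprime b D) :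
    quadGauss D b = jacobiSym b D * eps D * √D := by
  induction D using Nat.strong_induction_on generalizing b hNZ with
  | _ D ih =>
  rcases eq_or_ne D 1 with rfl | hD1
  · rw [quadGauss_congr (b' := 1) (Subsingleton.elim _ _), quadGauss_one hD]
    simp
  have hD0 : 1 < D := by have := NeZero.pos D; omega
  -- For odd `n < D`, `quadGauss_mul_quadGauss` trades modulus `D` for modulus `n`, where the
  -- induction hypothesis applies. Jacobi reciprocity then matches the symbols, case by case mod 4.
  have key : ∀ n : ℕ, Odd n → n < D → n.Coprime D →
      quadGauss D n = jacobiSym n D * eps D * √D := by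
    intro n hn hnD hcop
    have : NeZero n := ⟨hn.pos.ne'⟩
    have h1 := quadGauss_mul_quadGauss hcop
    rw [quadGauss_one (hn.mul hD), ih n hnD hn (b := D) (Nat.isCoprime_iff_coprime.2 hcop.symm)] at h1
    have hs : ((√(n * D : ℕ) : ℝ) : ℂ) = √n * √D := by
      push_cast
      rw [Real.sqrt_mul (by positivity)]
      push_cast; rfl
    have hn0 : ((√n : ℝ) : ℂ) ≠ 0 := by
      exact_mod_cast (Real.sqrt_pos.2 (by exact_mod_cast hn.pos)).ne'
    rw [hs] at h1
    have hj : (jacobiSym D n : ℂ) ^ 2 = 1 := by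
      exact_mod_cast jacobiSym.sq_one (b := n) (a := D) (by simpa using hcop.symm)
    have hI := I_sq
    have h2 : jacobiSym D n * eps n * quadGauss D n = eps (n * D : ℕ) * √D := by
      apply mul_left_cancel₀ hn0
      linear_combination h1
    rcases Nat.odd_mod_four_iff.1 (Nat.odd_iff.1 hD) with hD4 | hD4 <;>
      rcases Nat.odd_mod_four_iff.1 (Nat.odd_iff.1 hn) with hn4 | hn4
    · rw [eps_natCast_of_mod_four_eq_one hD4, jacobiSym.quadratic_reciprocity_one_mod_four hn4 hD]
      rw [eps_natCast_of_mod_four_eq_one hn4,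
        eps_natCast_of_mod_four_eq_one (by rw [Nat.mul_mod, hD4, hn4])] at h2
      linear_combination (jacobiSym D n : ℂ) * h2 - quadGauss D n * hj
    · rw [eps_natCast_of_mod_four_eq_one hD4, jacobiSym.quadratic_reciprocity_one_mod_four' hn hD4]
      rw [eps_natCast_of_mod_four_eq_three hn4,
        eps_natCast_of_mod_four_eq_three (by rw [Nat.mul_mod, hD4, hn4])] at h2
      have h3 := mul_left_cancel₀ I_ne_zero
        (show I * (jacobiSym D n * quadGauss D n) = I * √D by linear_combination h2)
      linear_combination (jacobiSym D n : ℂ) * h3 - quadGauss D n * hj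
    · rw [eps_natCast_of_mod_four_eq_three hD4, jacobiSym.quadratic_reciprocity_one_mod_four hn4 hD]
      rw [eps_natCast_of_mod_four_eq_one hn4,
        eps_natCast_of_mod_four_eq_three (by rw [Nat.mul_mod, hD4, hn4])] at h2
      linear_combination (jacobiSym D n : ℂ) * h2 - quadGauss D n * hj
    · rw [eps_natCast_of_mod_four_eq_three hD4,
        jacobiSym.quadratic_reciprocity_three_mod_four hn4 hD4]
      rw [eps_natCast_of_mod_four_eq_three hn4,
        eps_natCast_of_mod_four_eq_one (by rw [Nat.mul_mod, hD4, hn4])] at h2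
      push_cast
      linear_combination -I * (jacobiSym D n : ℂ) * h2 - quadGauss D n * hj +
        (jacobiSym D n : ℂ) ^ 2 * quadGauss D n * hI
  have hr0 : 0 ≤ b % D := Int.emod_nonneg _ (by omega)
  have hrD : b % D < D := Int.emod_lt_of_pos _ (by omega)
  obtain ⟨r, hr⟩ := Int.eq_ofNat_of_zero_le hr0
  have hbr : (b : ZMod D) = ((r : ℤ) : ZMod D) := by
    rw [← hr]; simp
  have hdiv := Int.mul_ediv_add_emod b D
  have hcop : IsCoprime (r : ℤ) D := by
    obtain ⟨x, y, hxy⟩ := hb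
    refine ⟨x, y + x * (b / D), ?_⟩
    rw [← hr]
    linear_combination hxy + x * hdiv
  -- Reciprocity needs an odd numerator. An even residue `r` is replaced by `-(D - r)`, and the
  -- minus sign conjugates the Gauss sum.
  rcases Nat.even_or_odd r with hre | hro
  · obtain ⟨n, hn⟩ : ∃ n, n + r = D := ⟨D - r, by omega⟩
    have hno : Odd n := by
      rw [← hn, Nat.odd_add] at hD; exact hD.2 hre
    have hr1 : r ≠ 0 := by
      rintro rfl
      rw [Nat.cast_zero, isCoprime_zero_left] at hcop
      have := Int.isUnit_iff.1 hcop
      omega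
    have hbn : (b : ZMod D) = ((-n : ℤ) : ZMod D) := by
      rw [hbr]
      have := congrArg (Nat.cast : ℕ → ZMod D) hn
      push_cast at this ⊢
      rw [natCast_self] at this
      linear_combination this
    have hncop : n.Coprime D := by
      rw [← Nat.isCoprime_iff_coprime]
      obtain ⟨x, y, hxy⟩ := hcop
      refine ⟨-x, y + x, ?_⟩
      have : (n : ℤ) + r = D := by exact_mod_cast hn
      linear_combination hxy - x * this
    have hmod : b % D = (-n : ℤ) % D := (ZMod.intCast_eq_intCast_iff _ _ _).1 hbn
    rw [quadGauss_congr hbn, quadGauss_neg, key n hno (by omega) hncop, jacobiSym.mod_left' hmod,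
      jacobiSym.neg _ hD]
    rcases Nat.odd_mod_four_iff.1 (Nat.odd_iff.1 hD) with hD4 | hD4
    · rw [eps_natCast_of_mod_four_eq_one hD4, ZMod.χ₄_nat_one_mod_four hD4]
      simp
    · rw [eps_natCast_of_mod_four_eq_three hD4, ZMod.χ₄_nat_three_mod_four hD4]
      simp
  · rw [quadGauss_congr hbr, key r hro (by omega) (Nat.isCoprime_iff_coprime.1 hcop),
      jacobiSym.mod_left b, hr]

/-! ### The transformation law under the congruence subgroups -/

theorem thetaSeries_comp_castHom {p M : ℕ} (h : p ∣ M) (F : ZMod p → ℂ) (τ : ℂ) :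
    thetaSeries (fun x : ZMod M => F (castHom h (ZMod p) x)) τ = thetaSeries F τ := by
  unfold thetaSeries
  simp only [map_intCast]

theorem stdAddChar_mul_left {N D : ℕ} [NeZero N] [NeZero D] (b : ℤ) (x : ZMod (N * D)) :
    (stdAddChar (((b * N : ℤ) : ZMod (N * D)) * x) : ℂ) =
      stdAddChar ((b : ZMod D) * castHom (Dvd.intro_left _ rfl) (ZMod D) x) := by
  obtain ⟨x, rfl⟩ := ZMod.intCast_surjective x
  rw [map_intCast, stdAddChar_intCast_div, stdAddChar_intCast_div]
  congr 2
  have hN : (N : ℂ) ≠ 0 := NeZero.ne _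
  have hD : (D : ℂ) ≠ 0 := NeZero.ne _
  push_cast
  field_simp

/-- As `4N²c₀b ≡ -1` and `Nv ≡ 1`, the vertex `vm/(2b)` of the quadratic is `-2Nc₀m` mod `D`, with
no division needed. -/
theorem sum_stdAddChar_complete_square {D : ℕ} [NeZero D] {N b c₀ v : ℤ}
    (hv : ((N * v : ℤ) : ZMod D) = 1) (hb : ((4 * N ^ 2 * c₀ * b : ℤ) : ZMod D) = -1) (m : ZMod D) :
    ∑ j : ZMod D, (stdAddChar ((b : ZMod D) * j ^ 2 - (v : ZMod D) * m * j) : ℂ) =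
      stdAddChar ((c₀ : ZMod D) * m ^ 2) * quadGauss D b := by
  push_cast at hv hb
  rw [quadGauss, Finset.mul_sum,
    ← Equiv.sum_comp (Equiv.addRight (-(2 * N * c₀ * m : ZMod D)))]
  refine Finset.sum_congr rfl fun j _ => ?_
  rw [← AddChar.map_add_eq_mul]
  congr 1
  simp only [Equiv.coe_addRight]
  linear_combination (c₀ * m ^ 2 - m * j * v : ZMod D) * hb +
    (2 * c₀ * m ^ 2 + 4 * N * c₀ * b * m * j : ZMod D) * hv

/-- The transform factors by the Chinese remainder theorem: the part mod `N` is that of `F`, and the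
part mod `D` is a Gauss sum with a linear term, evaluated by completing the square. -/
theorem dft_thetaShift {N D : ℕ} [NeZero N] [NeZero D] (F : ZMod N → ℂ) {b c₀ u v : ℤ}
    (huv : D * u + N * v = 1) (hb : ((4 * N ^ 2 * c₀ * b : ℤ) : ZMod D) = -1)
    (m : ZMod (N * D)) :
    ZMod.dft (fun x : ZMod (N * D) => F (castHom (Dvd.intro _ rfl) (ZMod N) x) *
      stdAddChar (((b * N : ℤ) : ZMod (N * D)) * x ^ 2)) m =
    ZMod.dft F (u * castHom (Dvd.intro _ rfl) (ZMod N) m) * quadGauss D b *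
      stdAddChar (((c₀ * N : ℤ) : ZMod (N * D)) * m ^ 2) := by
  have hcop : N.Coprime D := by
    rw [← Nat.isCoprime_iff_coprime]; exact ⟨v, u, by linarith⟩
  have hv : ((N * v : ℤ) : ZMod D) = 1 := by
    have := congrArg (Int.cast : ℤ → ZMod D) huv
    simpa using this
  rw [stdAddChar_mul_left, map_pow, mul_assoc, mul_comm (quadGauss D b),
    ← sum_stdAddChar_complete_square hv hb, dft_apply, dft_apply, ← sum_mul_castHom hcop]
  refine Finset.sum_congr rfl fun r _ => ?_
  rw [stdAddChar_mul_left, stdAddChar_mul_eq huv, sub_eq_add_neg, AddChar.map_add_eq_mul]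
  simp only [smul_eq_mul, map_neg, map_mul, map_pow]
  ring_nf

/-- Poisson summation is applied at `gτ - b/D`, and again in reverse at `-1/τ`. In between, the
quadratic character produced by `dft_thetaShift` is undone by the translation by `-c₀/D`, and only
the Gauss sum remains. -/
theorem thetaSeries_moebius_pos {N D : ℕ} [NeZero N] [NeZero D] (F : ZMod N → ℂ)
    {a b c₀ u v : ℤ} (hdet : a * D - b * (4 * N ^ 2 * c₀) = 1) (hu : u = 1 ∨ u = -1)
    (huv : D * u + N * v = 1) {τ : ℂ} (hτ : 0 < τ.im) :
    thetaSeries F ((a * τ + b) / ((4 * N ^ 2 * c₀) * τ + D)) =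
      quadGauss D b / √D * ((4 * N ^ 2 * c₀) * τ + D) ^ (1 / 2 : ℂ) * thetaSeries F τ := by
  have hN : (N : ℂ) ≠ 0 := NeZero.ne _
  have hD : (D : ℂ) ≠ 0 := NeZero.ne _
  have hDr : (0 : ℝ) < D := by exact_mod_cast NeZero.pos D
  have hτ0 : τ ≠ 0 := fun h => by simp [h] at hτ
  have hb : ((4 * N ^ 2 * c₀ * b : ℤ) : ZMod D) = -1 := by
    have := congrArg (Int.cast : ℤ → ZMod D) hdet
    push_cast at this ⊢
    rw [natCast_self] at this
    linear_combination -this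
  have hdet' : (a : ℂ) * D - b * (4 * N ^ 2 * c₀) = 1 := by exact_mod_cast hdet
  set j : ℂ := (4 * N ^ 2 * c₀) * τ + D with hj
  have hj0 : j ≠ 0 := by
    intro h
    rcases eq_or_ne c₀ 0 with rfl | hc
    · simp [hj, hD] at h
    · have := congrArg im h
      rw [hj, show (4 * (N : ℂ) ^ 2 * c₀) * τ + D = ((4 * (N : ℝ) ^ 2 * c₀ : ℝ) : ℂ) * τ + D by
        push_cast; rfl, add_im, im_ofReal_mul, natCast_im] at this
      have hN' : (N : ℝ) ≠ 0 := NeZero.ne _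
      have hc' : (c₀ : ℝ) ≠ 0 := by exact_mod_cast hc
      simp [hN', hc', hτ.ne'] at this
  set w : ℂ := -1 / τ with hw
  have hwim : 0 < w.im := neg_one_div_im_pos hτ
  -- Since `aD - bc = 1` with `c = 4N²c₀`, the difference `gτ - b/D` is `τ/(Dj)`, which is `-1/τ'`.
  set τ' : ℂ := w * (D * j) with hτ'
  have hτ'e : τ' = ((D ^ 2 : ℝ) : ℂ) * w + ((-(4 * N ^ 2 * c₀ * D) : ℝ) : ℂ) := by
    rw [hτ', hj, hw]; push_cast; field_simp; ring
  have hτ'im : 0 < τ'.im := by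
    rw [hτ'e, add_im, im_ofReal_mul, ofReal_im, add_zero]; positivity
  have e1 : (a * τ + b) / j = ((b * N : ℤ) : ℂ) / (N * D : ℕ) + -1 / τ' := by
    rw [hτ', hw]
    push_cast
    field_simp
    rw [hj]
    linear_combination τ * hdet'
  have e2 : τ' / (4 * (N * D : ℕ) ^ 2) = ((-c₀ * N : ℤ) : ℂ) / (N * D : ℕ) + w / (4 * N ^ 2) := by
    rw [hτ'e]; push_cast; field_simp; ring
  have e3 : (τ' / (2 * I)) ^ (1 / 2 : ℂ) = (w / (2 * I)) ^ (1 / 2 : ℂ) * (√D * j ^ (1 / 2 : ℂ)) := by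
    have h1 : τ' / (2 * I) = (w / (2 * I)) * (((D : ℝ) : ℂ) * j) := by rw [hτ']; push_cast; ring
    have h2 : 0 < (τ' / (2 * I)).re := by rw [div_two_I_re]; positivity
    have h3 : 0 < (w / (2 * I)).re := by rw [div_two_I_re]; positivity
    rw [h1] at h2 ⊢
    rw [cpow_half_mul_of_re_pos h3 h2, cpow_half_ofReal_mul hDr]
  -- The theta series is even in its weight, which is why `u = -1` is as good as `u = 1`.
  have e4 : thetaSeries (fun k : ZMod N => ZMod.dft F ((u : ZMod N) * k)) (w / (4 * N ^ 2)) =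
      thetaSeries (ZMod.dft F) (w / (4 * N ^ 2)) := by
    rcases hu with rfl | rfl
    · simp
    · rw [← thetaSeries_comp_neg (ZMod.dft F)]
      simp
  have e5 : thetaSeries F τ = (w / (2 * I)) ^ (1 / 2 : ℂ) / N *
      thetaSeries (ZMod.dft F) (w / (4 * N ^ 2)) := by
    rw [← thetaSeries_neg_one_div F hwim, hw]
    congr 1; field_simp
  have hsq : (√(D : ℝ) : ℂ) ^ 2 = D := by
    rw [← ofReal_pow, Real.sq_sqrt hDr.le]; simp
  have hs0 : (√(D : ℝ) : ℂ) ≠ 0 := by exact_mod_cast (Real.sqrt_pos.2 hDr).ne'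
  rw [e1, thetaSeries_add (Dvd.intro _ rfl), thetaSeries_neg_one_div _ hτ'im, e2,
    thetaSeries_add dvd_rfl, e3, e5]
  have e6 : (fun x : ZMod (N * D) => ZMod.dft (fun x : ZMod (N * D) =>
      F (castHom (Dvd.intro _ rfl) (ZMod N) x) * stdAddChar (((b * N : ℤ) : ZMod (N * D)) * x ^ 2))
      (castHom dvd_rfl (ZMod (N * D)) x) * stdAddChar (((-c₀ * N : ℤ) : ZMod (N * D)) * x ^ 2)) =
      fun x => quadGauss D b *
        (fun k : ZMod N => ZMod.dft F ((u : ZMod N) * k)) (castHom (Dvd.intro _ rfl) (ZMod N) x) := by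
    ext x
    rw [dft_thetaShift F huv hb, castHom_self, RingHom.id_apply, mul_assoc,
      ← AddChar.map_add_eq_mul]
    push_cast
    rw [show (c₀ : ZMod (N * D)) * N * x ^ 2 + -c₀ * N * x ^ 2 = 0 by ring, AddChar.map_zero_eq_one]
    ring
  rw [e6, thetaSeries_const_mul, thetaSeries_comp_castHom (Dvd.intro _ rfl)
    (fun k : ZMod N => ZMod.dft F ((u : ZMod N) * k)), e4]
  push_cast
  field_simp
  rw [← hsq]
  ring

theorem thetaSeries_smul {N : ℕ} [NeZero N] (F : ZMod N → ℂ) {g : SL(2, ℤ)}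
    (h4 : g 1 1 % 4 = 1) (hN : (N : ℤ) ∣ g 1 1 - 1) (hc : (4 * N ^ 2 : ℤ) ∣ g 1 0) (τ : ℍ) :
    thetaSeries F (g • τ : ℍ) = thetaMultiplier g τ * thetaSeries F τ := by
  obtain ⟨c₀, hc₀⟩ := hc
  obtain ⟨v, hv⟩ := hN
  have hdet : g 0 0 * g 1 1 - g 0 1 * g 1 0 = 1 := by
    have := g.det_coe
    rwa [Matrix.det_fin_two] at this
  rw [thetaMultiplier, eps, if_pos h4, UpperHalfPlane.coe_specialLinearGroup_apply]
  simp only [algebraMap_int_eq, eq_intCast, ofReal_intCast]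
  generalize g 0 0 = a, g 0 1 = b, g 1 0 = c, g 1 1 = e at *
  subst hc₀
  -- From `bc ≡ -1` mod `D`, the symbols of `-b` and `c` multiply to 1, hence agree.
  have hbc : ∀ D : ℕ, (D : ℤ) ∣ b * (4 * N ^ 2 * c₀) + 1 →
      jacobiSym (-b) D = jacobiSym (4 * N ^ 2 * c₀) D := by
    intro D hD
    have h1 : jacobiSym (-b) D * jacobiSym (4 * N ^ 2 * c₀) D = 1 := by
      rw [← jacobiSym.mul_left, jacobiSym.mod_left' (a₂ := 1), jacobiSym.one_left]
      refine Int.modEq_iff_dvd.2 ?_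
      convert! hD using 1
      ring
    rcases jacobiSym.trichotomy (-b) D with h | h | h <;> rw [h] at h1 ⊢ <;> linarith
  rcases lt_or_gt_of_ne (show e ≠ 0 by omega) with he | he
  · obtain ⟨D, rfl⟩ : ∃ D : ℕ, e = -D := ⟨e.natAbs, by omega⟩
    have : NeZero D := ⟨by omega⟩
    have hDo : Odd D := Nat.odd_iff.2 (by omega)
    have hcop : IsCoprime (-b) D := ⟨4 * N ^ 2 * c₀, -a, by linear_combination hdet⟩
    -- For negative lower right entry `-D` the formula is applied to `-g`, which acts in the same
    -- way. Then `D ≡ 3` mod 4, and the factor `ε_D = i` combines with the `±i` from the square root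
    -- of `-(cτ + e)` to give the sign of `c` in `quadSymbol`.
    have h := thetaSeries_moebius_pos F (a := -a) (b := -b) (c₀ := -c₀) (D := D) (u := -1)
      (v := -v) (by linear_combination hdet) (Or.inr rfl) (by linear_combination hv) τ.2
    have hs0 : (√(D : ℝ) : ℂ) ≠ 0 := by
      exact_mod_cast (Real.sqrt_pos.2 (by exact_mod_cast NeZero.pos D)).ne'
    have hc0 : c₀ ≠ 0 := by
      rintro rfl
      have : a * (-D) = 1 := by linear_combination hdet
      rcases Int.eq_one_or_neg_one_of_mul_eq_one' this with h | h <;> omega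
    have hN0 : (N : ℤ) ≠ 0 := NeZero.ne _
    have hNr : (0 : ℝ) < N := by exact_mod_cast NeZero.pos N
    rw [quadGauss_eq hDo hcop, eps_natCast_of_mod_four_eq_three (by omega),
      hbc D ⟨-a, by linear_combination -hdet⟩] at h
    have e1 : 4 * (N : ℂ) ^ 2 * ((-c₀ : ℤ) : ℂ) * (τ : ℂ) + D =
        -(((4 * N ^ 2 * c₀ : ℤ) : ℂ) * τ + ((-D : ℤ) : ℂ)) := by push_cast; ring
    have e2 : (((-a : ℤ) : ℂ) * (τ : ℂ) + ((-b : ℤ) : ℂ)) = -((a : ℂ) * τ + b) := by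
      push_cast; ring
    have him : (((4 * N ^ 2 * c₀ : ℤ) : ℂ) * τ + ((-D : ℤ) : ℂ)).im = 4 * N ^ 2 * c₀ * τ.im := by
      rw [show (((4 * N ^ 2 * c₀ : ℤ) : ℂ) * (τ : ℂ) + ((-D : ℤ) : ℂ)) =
        ((4 * N ^ 2 * c₀ : ℝ) : ℂ) * τ + ((-D : ℝ) : ℂ) by push_cast; ring, add_im,
        im_ofReal_mul, ofReal_im, add_zero]
      rfl
    rw [e1, e2, neg_div_neg_eq] at h
    rw [h, quadSymbol, if_neg (by positivity), if_pos he, Int.natAbs_neg, Int.natAbs_natCast,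
      Int.sign_mul, Int.sign_eq_one_of_pos (by positivity : (0 : ℤ) < 4 * N ^ 2)]
    have hI := I_sq
    rcases lt_or_gt_of_ne hc0 with hc | hc
    · rw [cpow_half_neg_of_im_neg (by
        rw [him]
        have : (c₀ : ℝ) < 0 := by exact_mod_cast hc
        have := τ.im_pos
        exact mul_neg_of_neg_of_pos (mul_neg_of_pos_of_neg (by positivity) ‹_›) this),
        Int.sign_eq_neg_one_of_neg hc]
      push_cast
      field_simp
      rw [hI]
      ring
    · rw [cpow_half_neg_of_im_pos (by
        rw [him]
        have : (0 : ℝ) < c₀ := by exact_mod_cast hc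
        have := τ.im_pos
        positivity), Int.sign_eq_one_of_pos hc]
      push_cast
      field_simp
      rw [hI]
      ring
  · obtain ⟨D, rfl⟩ : ∃ D : ℕ, e = D := ⟨e.natAbs, by omega⟩
    have : NeZero D := ⟨by omega⟩
    have hDo : Odd D := Nat.odd_iff.2 (by omega)
    have hcop : IsCoprime b D := ⟨-(4 * N ^ 2 * c₀), a, by linear_combination hdet⟩
    have h := thetaSeries_moebius_pos F hdet (Or.inl rfl)
      (show (D : ℤ) * 1 + N * (-v) = 1 by linear_combination hv) τ.2
    have hs0 : (√(D : ℝ) : ℂ) ≠ 0 := by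
      exact_mod_cast (Real.sqrt_pos.2 (by exact_mod_cast NeZero.pos D)).ne'
    -- Here `D ≡ 1` mod 4, so `-1` has symbol 1 and the symbols of `b` and `c` agree.
    have hq : quadSymbol (4 * N ^ 2 * c₀) D = jacobiSym b D := by
      have h1 := hbc D ⟨a, by linear_combination -hdet⟩
      rw [jacobiSym.neg _ hDo, ZMod.χ₄_nat_one_mod_four (by omega), one_mul] at h1
      rw [quadSymbol]
      split_ifs with h2 h3
      · rw [h1, h2]
        rcases h3 with h3 | h3
        · have : D = 1 := by omega
          subst this; simp
        · exact h3.elim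
      · exfalso
        rw [h2] at hdet
        have : a * D = 1 := by linear_combination hdet
        rcases Int.eq_one_or_neg_one_of_mul_eq_one' this with h | h <;> omega
      · omega
      · rw [h1, Int.natAbs_natCast]
    rw [quadGauss_eq hDo hcop, eps_natCast_of_mod_four_eq_one (by omega)] at h
    rw [hq]
    push_cast at h ⊢
    rw [h]
    field_simp

theorem theta_smul {N d : ℕ} [NeZero N] (F : (Fin d → ZMod N) → ℂ) {g : SL(2, ℤ)}
    (h4 : g 1 1 % 4 = 1) (hN : (N : ℤ) ∣ g 1 1 - 1) (hc : (4 * N ^ 2 : ℤ) ∣ g 1 0) (τ : ℍ) :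
    theta F (g • τ) = thetaMultiplier g τ ^ d * theta F τ := by
  simp_rw [theta_eq_sum_prod, thetaSeries_smul _ h4 hN hc, Finset.prod_mul_distrib,
    Finset.prod_const, Finset.card_univ, Fintype.card_fin, Finset.mul_sum]
  exact Finset.sum_congr rfl fun h _ => by ring

theorem quadSymbol_ne_zero {c e : ℤ} (h : IsCoprime c e) : quadSymbol c e ≠ 0 := by
  rw [quadSymbol]
  have hj : jacobiSym c e.natAbs ≠ 0 :=
    jacobiSym.ne_zero (by
      rw [Int.gcd, Int.natAbs_natCast]; exact Int.isCoprime_iff_gcd_eq_one.1 h)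
  split_ifs with h0 h1 h2
  · exact one_ne_zero
  · rw [h0, isCoprime_zero_left] at h
    exact absurd (Int.isUnit_iff.1 h) h1
  · exact mul_ne_zero (mt Int.sign_eq_zero_iff_zero.1 h0) hj
  · exact hj

theorem thetaMultiplier_ne_zero (g : SL(2, ℤ)) (τ : ℍ) : thetaMultiplier g τ ≠ 0 := by
  have hdet : g 0 0 * g 1 1 - g 0 1 * g 1 0 = 1 := by
    have := g.det_coe
    rwa [Matrix.det_fin_two] at this
  have h1 : eps (g 1 1) ≠ 0 := by
    rw [eps]; split_ifs <;> simp
  have h2 : quadSymbol (g 1 0) (g 1 1) ≠ 0 :=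
    quadSymbol_ne_zero ⟨-g 0 1, g 0 0, by linear_combination hdet⟩
  have h3 : (g 1 0 : ℂ) * (τ : ℂ) + (g 1 1 : ℂ) ≠ 0 := by
    have := UpperHalfPlane.denom_ne_zero (g : GL (Fin 2) ℝ) τ
    simpa [UpperHalfPlane.denom] using this
  rw [thetaMultiplier]
  refine mul_ne_zero (mul_ne_zero (inv_ne_zero h1) (by exact_mod_cast h2)) ?_
  rw [cpow_ne_zero_iff]
  exact Or.inl h3

theorem isWeaklyModular_theta {N d : ℕ} [NeZero N] (F : (Fin d → ZMod N) → ℂ)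
    {Γ : Subgroup SL(2, ℤ)} (h : ∀ g ∈ Γ, g 1 1 % 4 = 1 ∧ (N : ℤ) ∣ g 1 1 - 1 ∧
      (4 * N ^ 2 : ℤ) ∣ g 1 0) : IsWeaklyModular d Γ (theta F) := by
  intro g hg τ
  obtain ⟨h1, h2, h3⟩ := h g⁻¹ (inv_mem hg)
  rw [theta_smul F h1 h2 h3, zpow_neg, zpow_natCast, inv_mul_cancel_left₀]
  exact pow_ne_zero _ (thetaMultiplier_ne_zero _ _)

theorem isWeaklyModular_theta_levelTwo {d : ℕ} (f : (Fin d → ZMod 2) → ℂ) :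
    IsWeaklyModular d levelTwo (theta f) := by
  refine isWeaklyModular_theta f fun g hg => ?_
  obtain ⟨h1, h0⟩ := Subgroup.mem_inf.1 hg
  rw [CongruenceSubgroup.Gamma1_mem] at h1
  rw [CongruenceSubgroup.Gamma0_mem] at h0
  have h := (ZMod.intCast_eq_intCast_iff_dvd_sub (g 1 1) 1 4).1 (by simpa using h1.2.1)
  have h0 := (ZMod.intCast_zmod_eq_zero_iff_dvd (g 1 0) 16).1 h0
  push_cast at *
  exact ⟨by omega, by omega, h0⟩

theorem isWeaklyModular_theta_levelOdd {p d : ℕ} [NeZero p] (f : (Fin d → ZMod p) → ℂ) :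
    IsWeaklyModular d (levelOdd p) (theta f) := by
  refine isWeaklyModular_theta f fun g hg => ?_
  obtain ⟨h1, h0⟩ := Subgroup.mem_inf.1 hg
  rw [CongruenceSubgroup.Gamma1_mem] at h1
  rw [CongruenceSubgroup.Gamma0_mem] at h0
  have : NeZero (4 * p) := ⟨mul_ne_zero four_ne_zero (NeZero.ne p)⟩
  have : NeZero (4 * p ^ 2) := ⟨mul_ne_zero four_ne_zero (pow_ne_zero 2 (NeZero.ne p))⟩
  have h := (ZMod.intCast_eq_intCast_iff_dvd_sub (g 1 1) 1 (4 * p)).1 (by simpa using h1.2.1)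
  have h0 := (ZMod.intCast_zmod_eq_zero_iff_dvd (g 1 0) (4 * p ^ 2)).1 h0
  push_cast at h h0
  have h4 : (4 : ℤ) ∣ 1 - g 1 1 := (Dvd.intro _ rfl).trans h
  refine ⟨by omega, ?_, h0⟩
  rw [dvd_sub_comm]
  exact (Dvd.intro_left _ rfl).trans h

/-! ### Behaviour at the rational cusps -/

/-- The function `x ↦ f(x mod p) exp(2πi Q(x,x) A / M)` on `(ℤ/Mℤ)^d`, for `p ∣ M`. -/
def cuspTwist {p M d : ℕ} (h : p ∣ M) [NeZero M] (f : (Fin d → ZMod p) → ℂ) (A : ℤ)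
    (x : Fin d → ZMod M) : ℂ :=
  f (fun i => castHom h (ZMod p) (x i)) * stdAddChar ((A : ZMod M) * ∑ i, x i * x i)

theorem theta_add_neg_one_div {p M d : ℕ} (h : p ∣ M) [NeZero M] (f : (Fin d → ZMod p) → ℂ)
    (A : ℤ) {τ σ ρ : ℍ} (hσ : (σ : ℂ) = A / M + -1 / τ) (hρ : (ρ : ℂ) = τ / (4 * M ^ 2)) :
    theta f σ = (((τ : ℂ) / (2 * I)) ^ (1 / 2 : ℂ) / M) ^ d *
      theta (dftPi (cuspTwist h f A)) ρ := by
  let σ' : ℍ := ⟨-1 / τ, neg_one_div_im_pos τ.2⟩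
  rw [theta_add h f A (τ := σ') hσ]
  exact theta_neg_one_div (cuspTwist h f A) rfl hρ

/-- The map `τ ↦ s - 1/τ`, with a square root of `τ`. -/
def cuspMap (s : ℚ) : Metaplectic where
  mat := Matrix.GeneralLinearGroup.mkOfDetNeZero !![s, -1; 1, 0] (by simp [Matrix.det_fin_two])
  det_pos := by simp [Matrix.GeneralLinearGroup.mkOfDetNeZero, Matrix.det_fin_two]
  -- As `(1 + i)² = 2i`, this squares to `τ`; the branch is the one in the Poisson formula, so that
  -- the two factors cancel exactly.
  root := fun τ => ((τ : ℂ) / (2 * I)) ^ (1 / 2 : ℂ) * (1 + I)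
  holo := by
    rw [UpperHalfPlane.mdifferentiable_iff]
    have h : DifferentiableOn ℂ (fun τ : ℂ => (τ / (2 * I)) ^ (1 / 2 : ℂ) * (1 + I))
        {z | 0 < z.im} := by
      intro z hz
      refine DifferentiableAt.differentiableWithinAt (DifferentiableAt.mul_const ?_ _)
      refine DifferentiableAt.cpow_const (by fun_prop) (Or.inl ?_)
      rw [div_two_I_re]
      exact half_pos hz
    refine h.congr fun z hz => ?_
    simp [UpperHalfPlane.ofComplex_apply_of_im_pos hz]
  root_sq := fun τ => by
    rw [mul_pow, cpow_half_sq, autFactor]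
    simp [Matrix.GeneralLinearGroup.mkOfDetNeZero]
    field_simp
    rw [add_sq, I_sq]; ring

theorem toReal_inv_smul_smul (g : GL (Fin 2) ℚ) (τ : ℍ) : toReal g⁻¹ • toReal g • τ = τ := by
  rw [toReal, toReal, map_inv, inv_smul_smul]

theorem coe_toReal_smul {g : GL (Fin 2) ℚ} (hg : 0 < (g.det : ℚ)) (τ : ℍ) :
    ((toReal g • τ : ℍ) : ℂ) = ((g 0 0 : ℚ) * τ + (g 0 1 : ℚ)) / autFactor g τ := by
  rw [UpperHalfPlane.coe_smul_of_det_pos (toReal_det_pos hg), autFactor_eq_denom]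
  simp [UpperHalfPlane.num, toReal]

theorem cuspMap_inv_smul (s : ℚ) : (cuspMap s).inv.mat • (s : OnePoint ℚ) = OnePoint.infty := by
  have h : (cuspMap s).mat • (OnePoint.infty : OnePoint ℚ) = s := by
    rw [OnePoint.smul_infty_eq_ite]
    simp [cuspMap, Matrix.GeneralLinearGroup.mkOfDetNeZero]
  rw [← h]
  exact inv_smul_smul _ _

theorem metaAct_cuspMap_inv (n : ℤ) (s : ℚ) (ψ : ℍ → ℂ) (τ : ℍ) :
    metaAct n 0 (cuspMap s).inv ψ τ =
      (((τ : ℂ) / (2 * I)) ^ (1 / 2 : ℂ) * (1 + I)) ^ (-n) * ψ (toReal (cuspMap s).mat • τ) := by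
  have h1 : (cuspMap s).inv.mat⁻¹ = (cuspMap s).mat := inv_inv _
  have h2 : (cuspMap s).inv.inv.root τ = (cuspMap s).root τ := by
    change ((cuspMap s).root (toReal (cuspMap s).mat⁻¹ • (toReal (cuspMap s).inv.mat⁻¹ • τ)))⁻¹⁻¹ = _
    rw [h1, toReal_inv_smul_smul, inv_inv]
  rw [metaAct, h1, h2, neg_zero, cpow_zero, mul_one]
  rfl

theorem div_im_pos (τ : ℍ) {r : ℝ} (hr : 0 < r) : 0 < ((τ : ℂ) / r).im := by
  rw [div_ofReal_im]; exact div_pos τ.2 hr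

theorem hasFourierExpansion_metaAct_cuspMap {p M d : ℕ} (h : p ∣ M) [NeZero M]
    (f : (Fin d → ZMod p) → ℂ) (A : ℤ) :
    HasFourierExpansion (metaAct d 0 (cuspMap (A / M)).inv (theta f)) (4 * M ^ 2)
      (fun n => (((1 + I) * M) ^ d)⁻¹ * normCoeff (dftPi (cuspTwist h f A)) n) := by
  intro τ
  have hM : (M : ℂ) ≠ 0 := NeZero.ne _
  have hM' : (0 : ℝ) < M := by exact_mod_cast NeZero.pos M
  let ρ : ℍ := ⟨(τ : ℂ) / (4 * (M : ℝ) ^ 2 : ℝ), div_im_pos τ (by positivity)⟩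
  have hρ : (ρ : ℂ) = τ / (4 * M ^ 2) := by
    change (τ : ℂ) / (4 * (M : ℝ) ^ 2 : ℝ) = _
    push_cast; rfl
  have hτ0 : (τ : ℂ) ≠ 0 := τ.ne_zero
  have hσ : ((toReal (cuspMap (A / M)).mat • τ : ℍ) : ℂ) = A / M + -1 / τ := by
    rw [coe_toReal_smul (cuspMap _).det_pos, autFactor]
    simp [cuspMap, Matrix.GeneralLinearGroup.mkOfDetNeZero]
    field_simp
  have hq : ((τ : ℂ) / (2 * I)) ^ (1 / 2 : ℂ) ≠ 0 := by
    rw [cpow_ne_zero_iff]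
    exact Or.inl (div_ne_zero hτ0 (by simp))
  have hI : (1 + I : ℂ) ≠ 0 := fun h => by simpa using congrArg re h
  have e : metaAct d 0 (cuspMap (A / M)).inv (theta f) τ =
      (((1 + I) * M) ^ d)⁻¹ * theta (dftPi (cuspTwist h f A)) ρ := by
    rw [metaAct_cuspMap_inv, theta_add_neg_one_div h f A hσ hρ, zpow_neg, zpow_natCast, mul_pow,
      mul_pow, div_pow]
    field_simp
  rw [e]
  refine ((hasSum_theta_normCoeff (dftPi (cuspTwist h f A)) ρ).mul_left _).congr_fun fun n => ?_
  rw [hρ, ← mul_assoc]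
  congr 3
  push_cast
  ring

/-- The fraction is deliberately not reduced: a factor `p` in `M` makes both `f` and the character
periodic mod `M`. -/
theorem exists_eq_div_of_dvd {p : ℕ} [NeZero p] (s : ℚ) :
    ∃ (M : ℕ) (_ : NeZero M) (A : ℤ), p ∣ M ∧ s = (A : ℚ) / M :=
  ⟨p * s.den, ⟨mul_ne_zero (NeZero.ne p) s.den_nz⟩, p * s.num, Dvd.intro _ rfl, by
    have : (p : ℚ) ≠ 0 := NeZero.ne _
    push_cast
    rw [mul_div_mul_left _ _ this, Rat.num_div_den]⟩

theorem isHolomorphicAtRat_theta {p d : ℕ} [NeZero p] (f : (Fin d → ZMod p) → ℂ) (s : ℚ) :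
    IsHolomorphicAtRat d (theta f) s := by
  obtain ⟨M, _, A, h, rfl⟩ := exists_eq_div_of_dvd (p := p) s
  exact ⟨_, 0, cuspMap_inv_smul _, 4 * M ^ 2, pos_of_ne_zero (by simp [NeZero.ne M]), _,
    hasFourierExpansion_metaAct_cuspMap h f A⟩

theorem isZeroAtRat_theta_of_sum_eq_zero {p M d : ℕ} (h : p ∣ M) [NeZero M]
    (f : (Fin d → ZMod p) → ℂ) (A : ℤ) (h0 : ∑ x, cuspTwist h f A x = 0) :
    IsZeroAtRat d (theta f) (A / M) :=
  ⟨_, 0, cuspMap_inv_smul _, 4 * M ^ 2, pos_of_ne_zero (by simp [NeZero.ne M]), _,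
    hasFourierExpansion_metaAct_cuspMap h f A, by rw [normCoeff_zero, dftPi_zero, h0, mul_zero]⟩

/-- Vanishing is given only for some unknown metaplectic element, so the limit at `i∞` is compared
with the one computed from the Poisson formula. -/
theorem sum_eq_zero_of_isZeroAtRat_theta {p M d : ℕ} (h : p ∣ M) [NeZero M]
    (f : (Fin d → ZMod p) → ℂ) (A : ℤ) (h0 : IsZeroAtRat d (theta f) (A / M)) :
    ∑ x, cuspTwist h f A x = 0 := by
  obtain ⟨g, u, hg, m, hm, a, ha, ha0⟩ := h0
  have hlim := ha.tendsto hm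
  rw [ha0] at hlim
  have hM : (M : ℂ) ≠ 0 := NeZero.ne _
  have hM' : (0 : ℝ) < M := by exact_mod_cast NeZero.pos M
  set G := g.mat⁻¹ with hG
  have hGdet : 0 < (G.det : ℚ) := by simpa [hG] using g.det_pos
  have hG' : G • (OnePoint.infty : OnePoint ℚ) = ((A / M : ℚ) : OnePoint ℚ) := by
    rw [hG, ← hg, inv_smul_smul]
  rw [OnePoint.smul_infty_eq_ite] at hG'
  have hγ : G 1 0 ≠ 0 := fun h => by
    rw [if_pos h] at hG'
    exact OnePoint.infty_ne_coe _ hG'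
  rw [if_neg hγ] at hG'
  have hs : G 0 0 / G 1 0 = A / M := OnePoint.coe_injective hG'
  have hdet : (G.det : ℚ) = G 0 0 * G 1 1 - G 0 1 * G 1 0 := by
    simp [Matrix.det_fin_two]
  set Δ : ℚ := (G.det : ℚ) with hΔ
  set α := G 0 0
  set β := G 0 1
  set γ := G 1 0
  set δ := G 1 1
  have hΔ' : (0 : ℝ) < Δ := by exact_mod_cast hGdet
  have hΔ0 : (Δ : ℂ) ≠ 0 := by exact_mod_cast hGdet.ne'
  have hγ' : (γ : ℝ) ≠ 0 := by exact_mod_cast hγ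
  have hγ0 : (γ : ℂ) ≠ 0 := by exact_mod_cast hγ
  -- `Gτ = α/γ - Δ/(γ(γτ + δ))`, which is `A/M - 1/τ'` for the affine function `τ' = γ(γτ + δ)/Δ`
  -- with leading coefficient `k > 0`.
  let k : ℝ := (γ : ℝ) ^ 2 / Δ
  have hk : 0 < k := by positivity
  let τ' : ℍ → ℍ := fun τ => ⟨(k : ℂ) * τ + ((γ * δ / Δ : ℝ) : ℂ), by
    rw [add_im, im_ofReal_mul, ofReal_im, add_zero]
    exact mul_pos hk τ.2⟩
  let ρ : ℍ → ℍ := fun τ => ⟨(τ' τ : ℂ) / (4 * (M : ℝ) ^ 2 : ℝ), div_im_pos _ (by positivity)⟩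
  have hρ : ∀ τ, (ρ τ : ℂ) = (τ' τ : ℂ) / (4 * M ^ 2) := fun τ => by
    change (τ' τ : ℂ) / (4 * (M : ℝ) ^ 2 : ℝ) = _
    push_cast; rfl
  have hτ' : ∀ τ, (τ' τ : ℂ) = γ / Δ * autFactor G τ := fun τ => by
    change (k : ℂ) * τ + ((γ * δ / Δ : ℝ) : ℂ) = _
    rw [autFactor]
    simp only [k]
    push_cast
    ring
  have hρlim : Tendsto ρ UpperHalfPlane.atImInfty UpperHalfPlane.atImInfty := by
    refine tendsto_comap_iff.2 ?_
    have : UpperHalfPlane.im ∘ ρ = fun τ => τ.im * (k / (4 * (M : ℝ) ^ 2)) := by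
      ext τ
      change ((τ' τ : ℂ) / (4 * (M : ℝ) ^ 2 : ℝ)).im = _
      rw [div_ofReal_im]
      change ((k : ℂ) * τ + ((γ * δ / Δ : ℝ) : ℂ)).im / _ = _
      rw [add_im, im_ofReal_mul, ofReal_im, add_zero]
      change k * τ.im / _ = _
      ring
    rw [this]
    exact tendsto_comap.atTop_mul_const (by positivity)
  have hσ : ∀ τ : ℍ, ((toReal G • τ : ℍ) : ℂ) = A / M + -1 / (τ' τ : ℂ) := fun τ => by
    have hs' : (α : ℂ) / γ = A / M := by exact_mod_cast congrArg (Rat.cast : ℚ → ℂ) hs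
    have hdet' : (Δ : ℂ) = α * δ - β * γ := by
      rw [hdet]; push_cast; rfl
    have hj : autFactor G τ ≠ 0 := by
      rw [autFactor_eq_denom]; exact UpperHalfPlane.denom_ne_zero _ _
    rw [coe_toReal_smul hGdet, hτ', ← hs', div_eq_iff hj]
    field_simp
    rw [hdet', autFactor]
    ring
  let κ : ℂ := γ / (2 * I * Δ)
  have hκ : κ ≠ 0 := div_ne_zero hγ0 (by simpa using hΔ0)
  let c : ℂ := ((g.mat.det : ℚ) : ℂ) ^ (-u)
  have hc : c ≠ 0 := by
    rw [cpow_ne_zero_iff]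
    exact Or.inl (by exact_mod_cast g.det_pos.ne')
  -- Squaring removes the ambiguity between the arbitrary root in `g` and the principal one.
  have key : ∀ τ : ℍ, metaAct d u g (theta f) τ ^ 2 =
      c ^ 2 * (κ / M ^ 2) ^ d * theta (dftPi (cuspTwist h f A)) (ρ τ) ^ 2 := fun τ => by
    have hr : g.inv.root τ ^ 2 = autFactor G τ := g.inv.root_sq τ
    have hj : autFactor G τ ≠ 0 := by
      rw [autFactor_eq_denom]; exact UpperHalfPlane.denom_ne_zero _ _
    have hq : (((τ' τ : ℂ) / (2 * I)) ^ (1 / 2 : ℂ)) ^ 2 = κ * autFactor G τ := by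
      rw [cpow_half_sq, hτ']
      simp only [κ]
      field_simp
    rw [metaAct, theta_add_neg_one_div h f A (hσ τ) (hρ τ), zpow_neg, zpow_natCast]
    rw [mul_pow, mul_pow, mul_pow, inv_pow, ← pow_mul, ← pow_mul, mul_comm d 2, pow_mul, pow_mul,
      hr, div_pow, hq]
    rw [div_pow, div_pow, mul_pow]
    field_simp
    exact mul_comm _ _
  have hL := (((tendsto_theta (dftPi (cuspTwist h f A))).comp hρlim).pow 2).const_mul
    (c ^ 2 * (κ / M ^ 2) ^ d)
  have hz := tendsto_nhds_unique (hlim.pow 2) (hL.congr fun τ => (key τ).symm)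
  rw [dftPi_zero, zero_pow two_ne_zero] at hz
  have h1 : c ^ 2 * (κ / M ^ 2) ^ d ≠ 0 := by positivity
  exact pow_eq_zero_iff two_ne_zero |>.1 ((mul_eq_zero.1 hz.symm).resolve_left h1)

theorem isZeroAtInfty_theta_iff {N d : ℕ} [NeZero N] (f : (Fin d → ZMod N) → ℂ) :
    IsZeroAtInfty (theta f) ↔ f (fun _ => 0) = 0 := by
  constructor
  · rintro ⟨m, hm, a, ha, ha0⟩
    exact (tendsto_nhds_unique (tendsto_theta f) (ha.tendsto hm)).trans ha0
  · intro h
    exact ⟨1, one_pos, _, hasFourierExpansion_theta f, by rw [normCoeff_zero, h]⟩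

theorem isCuspForm_theta_iff {p d : ℕ} [NeZero p] (f : (Fin d → ZMod p) → ℂ)
    {Γ : Subgroup SL(2, ℤ)} (hΓ : IsWeaklyModular d Γ (theta f)) :
    IsCuspForm d Γ (theta f) ↔ f (fun _ => 0) = 0 ∧
      ∀ (M : ℕ) (h : p ∣ M) [NeZero M] (A : ℤ), ∑ x, cuspTwist h f A x = 0 := by
  constructor
  · intro h
    exact ⟨(isZeroAtInfty_theta_iff f).1 h.zero_infty, fun M hM _ A =>
      sum_eq_zero_of_isZeroAtRat_theta hM f A (h.zero_rat _)⟩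
  · rintro ⟨h0, h1⟩
    exact
      { holo := mdifferentiable_theta f
        weaklyModular := hΓ
        holo_infty := ⟨1, one_pos, _, hasFourierExpansion_theta f⟩
        holo_rat := isHolomorphicAtRat_theta f
        zero_infty := (isZeroAtInfty_theta_iff f).2 h0
        zero_rat := fun s => by
          obtain ⟨M, _, A, h, rfl⟩ := exists_eq_div_of_dvd (p := p) s
          exact isZeroAtRat_theta_of_sum_eq_zero h f A (h1 M h A) }

/-! ### Gauss sums over one residue class -/

/-- The partial Gauss sum over the residues modulo `M` in a given class modulo `p`. -/
def localSum {p M : ℕ} (h : p ∣ M) [NeZero M] (A : ℤ) (r : ZMod p) : ℂ :=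
  ∑ x : ZMod M with castHom h (ZMod p) x = r, stdAddChar ((A : ZMod M) * (x * x))

theorem map_sum_addChar {R ι : Type*} [AddCommMonoid R] (ψ : AddChar R ℂ) (s : Finset ι)
    (q : ι → R) : ψ (∑ i ∈ s, q i) = ∏ i ∈ s, ψ (q i) := by
  have := map_prod ψ.toMonoidHom (fun i => Multiplicative.ofAdd (q i)) s
  rwa [← ofAdd_sum] at this

theorem sum_cuspTwist {p M d : ℕ} (h : p ∣ M) [NeZero M] [NeZero p] (f : (Fin d → ZMod p) → ℂ)
    (A : ℤ) : ∑ x, cuspTwist h f A x = ∑ r, f r * ∏ i, localSum h A (r i) := by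
  rw [← Finset.sum_fiberwise Finset.univ (fun (x : Fin d → ZMod M) i => castHom h (ZMod p) (x i))]
  refine Finset.sum_congr rfl fun r _ => ?_
  simp_rw [localSum]
  rw [Finset.prod_univ_sum, Finset.mul_sum]
  refine Finset.sum_congr ?_ fun x hx => ?_
  · ext x
    simp only [Finset.mem_filter, Finset.mem_univ, true_and, Fintype.mem_piFinset, funext_iff]
  · have hx' : ∀ i, castHom h (ZMod p) (x i) = r i := fun i =>
      (Finset.mem_filter.1 (Fintype.mem_piFinset.1 hx i)).2
    rw [cuspTwist, Finset.mul_sum, map_sum_addChar]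
    simp_rw [hx']

/-- Substituting `x + y` multiplies each term by `e(A(2xy + y²)/M)`, assumed constant on the class.
A shift with `y ≡ 0` mod `p` and constant different from 1 forces the sum to vanish; other shifts
relate different classes. -/
theorem localSum_add {p M : ℕ} (h : p ∣ M) [NeZero M] (A : ℤ) {r : ZMod p} {y : ZMod M} {c : ℂ}
    (hc : ∀ x : ZMod M, castHom h (ZMod p) x = r →
      stdAddChar ((A : ZMod M) * (2 * x * y + y * y)) = c) :
    localSum h A (r + castHom h (ZMod p) y) = c * localSum h A r := by
  rw [localSum, localSum, Finset.mul_sum]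
  refine (Finset.sum_equiv (Equiv.addRight y) (fun x => ?_) fun x hx => ?_).symm
  · simp only [Finset.mem_filter, Finset.mem_univ, true_and, Equiv.coe_addRight, map_add,
      add_left_inj]
  · rw [← hc x (Finset.mem_filter.1 hx).2, ← AddChar.map_add_eq_mul]
    congr 1
    simp only [Equiv.coe_addRight]
    ring

theorem stdAddChar_eq_of_mul_eq {p M : ℕ} [NeZero p] [NeZero M] {n m : ℤ} (h : n * p = m * M) :
    (stdAddChar (n : ZMod M) : ℂ) = stdAddChar (m : ZMod p) := by
  rw [stdAddChar_coe, stdAddChar_coe]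
  congr 1
  have h' : (n : ℂ) * p = m * M := by exact_mod_cast h
  have hp : (p : ℂ) ≠ 0 := NeZero.ne _
  have hM : (M : ℂ) ≠ 0 := NeZero.ne _
  field_simp
  linear_combination h'

theorem localSum_add_intCast {p q M : ℕ} (h : p ∣ M) [NeZero q] [NeZero M] (A : ℤ) {r : ZMod p}
    {y : ℤ} {c : ℂ} (m : ℤ → ℤ) (hm : ∀ x : ℤ, A * (2 * x * y + y * y) * q = m x * M)
    (hc : ∀ x : ℤ, (x : ZMod p) = r → stdAddChar (m x : ZMod q) = c) :
    localSum h A (r + y) = c * localSum h A r := by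
  rw [← map_intCast (castHom h (ZMod p)) y]
  refine localSum_add h A fun x hx => ?_
  obtain ⟨x, rfl⟩ := ZMod.intCast_surjective x
  rw [map_intCast] at hx
  rw [← hc x hx, ← stdAddChar_eq_of_mul_eq (hm x)]
  push_cast
  rfl

theorem eq_zero_of_eq_mul_self {c z : ℂ} (hc : c ≠ 1) (h : z = c * z) : z = 0 := by
  have : (c - 1) * z = 0 := by linear_combination -h
  exact (mul_eq_zero.1 this).resolve_left (sub_ne_zero.2 hc)

theorem stdAddChar_ne_one {N : ℕ} [NeZero N] {x : ZMod N} (hx : x ≠ 0) :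
    (stdAddChar x : ℂ) ≠ 1 := fun h =>
  hx (injective_stdAddChar (h.trans (AddChar.map_zero_eq_one _).symm))

theorem exists_reduced_fraction (A : ℤ) (M : ℕ) [NeZero M] :
    ∃ (g a : ℤ) (c : ℕ), c ≠ 0 ∧ A = g * a ∧ (M : ℤ) = g * c ∧ IsCoprime a c := by
  have hM : (M : ℤ) ≠ 0 := NeZero.ne _
  have hg : Int.gcd A M ≠ 0 := fun h => hM (Int.gcd_eq_zero_iff.1 h).2
  obtain ⟨a, ha⟩ := Int.gcd_dvd_left (a := A) (b := M)
  obtain ⟨c, hc⟩ : (Int.gcd A M) ∣ M := by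
    exact_mod_cast Int.gcd_dvd_right (a := A) (b := M)
  refine ⟨Int.gcd A M, a, c, ?_, ha, by exact_mod_cast hc, ?_⟩
  · rintro rfl
    exact NeZero.ne M (by simpa using hc)
  · obtain ⟨x, y, hxy⟩ : ∃ x y, (Int.gcd A M : ℤ) = A * x + M * y :=
      ⟨_, _, Int.gcd_eq_gcd_ab A M⟩
    have hc' : (M : ℤ) = Int.gcd A M * c := by exact_mod_cast hc
    refine ⟨x, y, mul_left_cancel₀ (Int.natCast_ne_zero.2 hg) ?_⟩
    linear_combination -hxy - x * ha - y * hc'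

theorem sum_mul_stdAddChar {α : Type*} [Fintype α] {N : ℕ} [NeZero N] (q : α → ZMod N)
    (f : α → ℂ) (t : ZMod N) :
    ∑ x, f x * stdAddChar (t * q x) = ∑ a, stdAddChar (t * a) * ∑ x with q x = a, f x := by
  rw [← Finset.sum_fiberwise Finset.univ q]
  refine Finset.sum_congr rfl fun a _ => ?_
  rw [Finset.mul_sum]
  refine Finset.sum_congr rfl fun x hx => ?_
  rw [(Finset.mem_filter.1 hx).2, mul_comm]

/-- The hypothesis says that the Fourier transform of the fibre sums vanishes, and the transform is
injective. -/
theorem sum_fiber_eq_zero {α : Type*} [Fintype α] {N : ℕ} [NeZero N] (q : α → ZMod N)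
    (f : α → ℂ) (h : ∀ A : ℤ, ∑ x, f x * stdAddChar ((A : ZMod N) * q x) = 0) (a : ZMod N) :
    ∑ x with q x = a, f x = 0 := by
  have h0 : ZMod.dft (fun a => ∑ x with q x = a, f x) = 0 := by
    ext k
    obtain ⟨A, hA⟩ := ZMod.intCast_surjective (-k)
    rw [dft_apply, Pi.zero_apply, ← h A, sum_mul_stdAddChar]
    refine Finset.sum_congr rfl fun a _ => ?_
    rw [hA, smul_eq_mul]
    congr 2
    ring
  exact congrFun ((LinearEquiv.map_eq_zero_iff _).1 h0) a

theorem prod_mul_stdAddChar {ι : Type*} [Fintype ι] {N : ℕ} [NeZero N] (z : ℂ) (t : ZMod N)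
    (q : ι → ZMod N) : ∏ i, stdAddChar (t * q i) * z =
      z ^ Fintype.card ι * stdAddChar (t * ∑ i, q i) := by
  rw [Finset.prod_mul_distrib, Finset.prod_const, Finset.card_univ, mul_comm, Finset.mul_sum,
    map_sum_addChar]

/-! ### The cusp sums for odd `p` -/

theorem sum_cuspTwist_eq_zero_of_odd {p M d : ℕ} (h : p ∣ M) [NeZero M] [Fact p.Prime]
    (hp2 : p ≠ 2) (f : (Fin d → ZMod p) → ℂ) (A : ℤ)
    (hf : ∀ a, ∑ x ∈ quadric p d a, f x = 0) (hf0 : f (fun _ => 0) = 0) :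
    ∑ x, cuspTwist h f A x = 0 := by
  have hp : p.Prime := Fact.out
  rw [sum_cuspTwist]
  obtain ⟨g, a, c, hc0, hA, hM, hac⟩ := exists_reduced_fraction A M
  obtain ⟨k, c', hc', hk⟩ := Nat.exists_eq_pow_mul_and_not_dvd hc0 p hp.ne_one
  by_cases hk2 : 2 ≤ k
  · obtain ⟨l, rfl⟩ := Nat.exists_eq_add_of_le hk2
    have hpa : (a : ZMod p) ≠ 0 := by
      intro h0
      rw [ZMod.intCast_zmod_eq_zero_iff_dvd] at h0
      have h1 : (p : ℤ) ∣ c := by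
        rw [hk, pow_add, mul_assoc, pow_two, mul_assoc]
        exact_mod_cast Dvd.intro _ rfl
      have := hac.isUnit_of_dvd' h0 h1
      rw [Int.isUnit_iff_natAbs_eq, Int.natAbs_natCast] at this
      exact hp.ne_one this
    have h2 : (2 : ZMod p) ≠ 0 := by
      intro h0
      have : p ∣ 2 := (ZMod.natCast_eq_zero_iff 2 p).1 (by exact_mod_cast h0)
      exact hp2 ((Nat.prime_dvd_prime_iff_eq hp Nat.prime_two).1 this)
    have hz : ∀ r : ZMod p, r ≠ 0 → localSum h A r = 0 := by
      intro r hr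
      refine eq_zero_of_eq_mul_self (c := stdAddChar (2 * a * r : ZMod p))
        (stdAddChar_ne_one (mul_ne_zero (mul_ne_zero h2 hpa) hr)) ?_
      -- The shift is `y = c/p`, divisible by `p` because `p² ∣ c`. The square term is then integral
      -- and the cross term contributes `2ar/p`.
      have := localSum_add_intCast h A (r := r) (y := p * (p ^ l * c' : ℕ)) (q := p)
        (c := stdAddChar (2 * a * r : ZMod p))
        (fun x => 2 * a * x + p * (a * (p ^ l * c' : ℕ))) (fun x => by
          rw [hA, hM, hk]; push_cast; ring) (fun x hx => by
          rw [← hx]; push_cast; rw [natCast_self]; congr 1; ring)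
      simpa using this
    refine Finset.sum_eq_zero fun r _ => ?_
    by_cases hr : r = fun _ => 0
    · rw [hr, hf0, zero_mul]
    · obtain ⟨i, hi⟩ : ∃ i, r i ≠ 0 := by
        by_contra! h'
        exact hr (funext h')
      rw [Finset.prod_eq_zero (Finset.mem_univ i) (hz _ hi), mul_zero]
  · obtain ⟨a', ha'⟩ : ∃ a' : ℤ, A * c' * p = a' * M := by
      interval_cases k
      · exact ⟨a * p, by rw [hA, hM, hk]; push_cast; ring⟩
      · exact ⟨a, by rw [hA, hM, hk]; push_cast; ring⟩
    have hcz : (c' : ZMod p) ≠ 0 := by rwa [Ne, ZMod.natCast_eq_zero_iff]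
    have hg : ∀ r : ZMod p, localSum h A r =
        stdAddChar (((a' : ZMod p) * (c' : ZMod p)⁻¹) * (r * r)) * localSum h A 0 := by
      intro r
      -- The shift `c' * y` lifts `r` and is divisible by the prime-to-`p` part of the denominator,
      -- so only `p`-th roots of unity appear.
      obtain ⟨y, hy⟩ := ZMod.intCast_surjective ((c' : ZMod p)⁻¹ * r)
      have hcy : (c' : ZMod p) * y = r := by rw [hy, mul_inv_cancel_left₀ hcz]
      have := localSum_add_intCast h A (r := 0) (y := c' * y) (q := p)
        (c := stdAddChar (((a' : ZMod p) * (c' : ZMod p)⁻¹) * (r * r)))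
        (fun x => a' * (2 * x * y + c' * y * y)) (fun x => by
          linear_combination (2 * x * y + c' * y * y) * ha') (fun x hx => by
          push_cast; rw [hx, ← hcy]; congr 1; field_simp; ring)
      rw [← this]
      push_cast
      rw [hcy, zero_add]
    have hr : ∀ r : Fin d → ZMod p, f r * ∏ i, localSum h A (r i) = localSum h A 0 ^ d *
        (f r * stdAddChar (((a' : ZMod p) * (c' : ZMod p)⁻¹) * ∑ i, r i * r i)) := by
      intro r
      rw [Finset.prod_congr rfl fun i _ => hg (r i), prod_mul_stdAddChar, Fintype.card_fin,
        mul_left_comm]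
    simp_rw [hr, ← Finset.mul_sum]
    rw [sum_mul_stdAddChar (fun x : Fin d → ZMod p => ∑ i, x i * x i)]
    refine mul_eq_zero_of_right _ (Finset.sum_eq_zero fun b _ => ?_)
    exact mul_eq_zero_of_right _ (hf b)

theorem sum_quadric_eq_zero {p d : ℕ} [NeZero p] (f : (Fin d → ZMod p) → ℂ)
    (h : ∀ (M : ℕ) (h : p ∣ M) [NeZero M] (A : ℤ), ∑ x, cuspTwist h f A x = 0) (a : ZMod p) :
    ∑ x ∈ quadric p d a, f x = 0 := by
  refine sum_fiber_eq_zero (fun x : Fin d → ZMod p => ∑ i, x i * x i) f (fun A => ?_) a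
  rw [← h p dvd_rfl A]
  simp [cuspTwist]

/-! ### The cusp sums for `p = 2` -/

theorem localSum_four_one {M : ℕ} (h : 2 ∣ M) [NeZero M] {A a : ℤ} {c : ℕ} (hc : Odd c)
    (ha : A * c * 4 = a * M) (r : ZMod 2) :
    localSum h A r = stdAddChar (((a * c : ℤ) : ZMod 4) * ((r.val : ZMod 4) * (r.val : ZMod 4))) *
      localSum h A 0 := by
  have hcz : (c : ZMod 2) = 1 := ZMod.natCast_eq_one_iff_odd.2 hc
  have h1 := localSum_add_intCast h A (r := 0) (y := c) (q := 4)
    (c := stdAddChar (((a * c : ℤ) : ZMod 4))) (fun x => a * (2 * x + c)) (fun x => by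
      push_cast
      linear_combination (2 * x + c) * ha) (fun x hx => by
      obtain ⟨z, rfl⟩ := (ZMod.intCast_zmod_eq_zero_iff_dvd x 2).1 hx
      congr 1
      push_cast
      have : (4 : ZMod 4) = 0 := rfl
      linear_combination (a * z : ZMod 4) * this)
  rw [zero_add, Int.cast_natCast, hcz] at h1
  have hr : r = 0 ∨ r = 1 := by
    revert r; decide
  rcases hr with rfl | rfl
  · rw [ZMod.val_zero, Nat.cast_zero, mul_zero, mul_zero, AddChar.map_zero_eq_one, one_mul]
  · rw [h1, ZMod.val_one, Nat.cast_one, mul_one, mul_one]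

/-- Shifting by `2c` changes the phase by `a(x + c)/2`, a half-integer for even `x`: the even class
cancels. -/
theorem localSum_zero_of_eight {M : ℕ} (h : 2 ∣ M) [NeZero M] {A g a : ℤ} {c : ℕ} (ha : Odd a)
    (hc : Odd c) (hA : A = g * a) (hM : (M : ℤ) = g * (8 * c)) : localSum h A 0 = 0 := by
  have hcz : (c : ZMod 2) = 1 := ZMod.natCast_eq_one_iff_odd.2 hc
  have haz : (a : ZMod 2) = 1 := ZMod.intCast_eq_one_iff_odd.2 ha
  refine eq_zero_of_eq_mul_self (c := stdAddChar (1 : ZMod 2)) (stdAddChar_ne_one one_ne_zero) ?_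
  have h1 := localSum_add_intCast h A (r := 0) (y := 2 * c) (q := 2)
    (c := stdAddChar (1 : ZMod 2)) (fun x => a * (x + c)) (fun x => by
      rw [hA, hM]; push_cast; ring) (fun x hx => by
      push_cast; rw [hx, hcz, haz]; simp)
  have h2 : (2 : ZMod 2) = 0 := rfl
  push_cast at h1
  rwa [h2, zero_mul, zero_add] at h1

/-- Shifting by `4c` changes the phase by `a(x + 2c)/2`, a half-integer for odd `x`: the odd class
cancels. -/
theorem localSum_one_of_sixteen {M : ℕ} (h : 2 ∣ M) [NeZero M] {A g a c : ℤ} (ha : Odd a)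
    (hA : A = g * a) (hM : (M : ℤ) = g * (16 * c)) : localSum h A 1 = 0 := by
  have haz : (a : ZMod 2) = 1 := ZMod.intCast_eq_one_iff_odd.2 ha
  have h2 : (2 : ZMod 2) = 0 := rfl
  have h4 : (4 : ZMod 2) = 0 := rfl
  refine eq_zero_of_eq_mul_self (c := stdAddChar (1 : ZMod 2)) (stdAddChar_ne_one one_ne_zero) ?_
  have h1 := localSum_add_intCast h A (r := 1) (y := 4 * c) (q := 2)
    (c := stdAddChar (1 : ZMod 2)) (fun x => a * (x + 2 * c)) (fun x => by
      rw [hA, hM]; push_cast; ring) (fun x hx => by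
      push_cast; rw [hx, haz, h2]; simp)
  push_cast at h1
  rwa [h4, zero_mul, add_zero] at h1

theorem sum_mul_prod_localSum_four {M d : ℕ} (h : 2 ∣ M) [NeZero M] {A a : ℤ} {c : ℕ} (hc : Odd c)
    (ha : A * c * 4 = a * M) (f : (Fin d → ZMod 2) → ℂ) :
    ∑ r, f r * ∏ i, localSum h A (r i) = localSum h A 0 ^ d *
      ∑ r, f r * stdAddChar (((a * c : ℤ) : ZMod 4) * qFour r) := by
  rw [Finset.mul_sum]
  refine Finset.sum_congr rfl fun r _ => ?_
  simp_rw [localSum_four_one h hc ha (r _)]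
  rw [prod_mul_stdAddChar, Fintype.card_fin, mul_left_comm, qFour]

theorem sum_cuspTwist_two_eq_zero {M d : ℕ} (h : 2 ∣ M) [NeZero M]
    (f : (Fin d → ZMod 2) → ℂ) (A : ℤ) (hf : ∀ a, ∑ x ∈ quadricTwo d a, f x = 0)
    (hf1 : f (fun _ => 1) = 0) (hf0 : f (fun _ => 0) = 0) :
    ∑ x, cuspTwist h f A x = 0 := by
  rw [sum_cuspTwist]
  obtain ⟨g, a, c, hc0, hA, hM, hac⟩ := exists_reduced_fraction A M
  obtain ⟨k, c', hc', hk⟩ := Nat.exists_eq_two_pow_mul_odd hc0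
  -- When only the class `b` has nonzero local sum, the constant vector `b` is the only index left.
  have hvanish : ∀ b : ZMod 2, (∀ r, r ≠ b → localSum h A r = 0) → f (fun _ => b) = 0 →
      ∑ r, f r * ∏ i, localSum h A (r i) = 0 := by
    intro b hb hfb
    refine Finset.sum_eq_zero fun r _ => ?_
    by_cases hr : r = fun _ => b
    · rw [hr, hfb, zero_mul]
    · obtain ⟨i, hi⟩ : ∃ i, r i ≠ b := by
        by_contra! h'
        exact hr (funext h')
      rw [Finset.prod_eq_zero (Finset.mem_univ i) (hb _ hi), mul_zero]
  have hne : ∀ r : ZMod 2, (r ≠ 0 → r = 1) ∧ (r ≠ 1 → r = 0) := by decide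
  by_cases hk3 : k < 3
  · obtain ⟨a', ha'⟩ : ∃ a' : ℤ, A * c' * 4 = a' * M := by
      interval_cases k
      · exact ⟨a * 4, by rw [hA, hM, hk]; push_cast; ring⟩
      · exact ⟨a * 2, by rw [hA, hM, hk]; push_cast; ring⟩
      · exact ⟨a, by rw [hA, hM, hk]; push_cast; ring⟩
    rw [sum_mul_prod_localSum_four h hc' ha', sum_mul_stdAddChar]
    exact mul_eq_zero_of_right _ (Finset.sum_eq_zero fun b _ => mul_eq_zero_of_right _ (hf b))
  · have ha : Odd a := by
      rw [← Int.not_even_iff_odd]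
      intro hev
      have h1 : (2 : ℤ) ∣ c := by
        rw [hk]
        push_cast
        exact Dvd.dvd.mul_right (dvd_pow_self 2 (by omega)) _
      have := hac.isUnit_of_dvd' hev.two_dvd h1
      rw [Int.isUnit_iff] at this
      omega
    rcases eq_or_ne k 3 with rfl | hk4
    · refine hvanish 1 (fun r hr => ?_) hf1
      rw [(hne r).2 hr]
      exact localSum_zero_of_eight h ha hc' hA (by rw [hM, hk]; push_cast; ring)
    · obtain ⟨l, rfl⟩ := Nat.exists_eq_add_of_le (show 4 ≤ k by omega)
      refine hvanish 0 (fun r hr => ?_) hf0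
      rw [(hne r).1 hr]
      exact localSum_one_of_sixteen (c := 2 ^ l * c') h ha hA (by rw [hM, hk]; push_cast; ring)

theorem even_residues_four (h : 2 ∣ 4) :
    (∀ x : ZMod 4, castHom h (ZMod 2) x = 0 → x * x = 0) ∧
      (Finset.univ.filter fun x : ZMod 4 => castHom h (ZMod 2) x = 0).card = 2 := by
  decide +revert

theorem odd_residues_eight (h : 2 ∣ 8) :
    (∀ x : ZMod 8, castHom h (ZMod 2) x = 1 → x * x = 1) ∧
      (Finset.univ.filter fun x : ZMod 8 => castHom h (ZMod 2) x = 1).card = 4 := by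
  decide +revert

theorem sum_quadricTwo_eq_zero {d : ℕ} (f : (Fin d → ZMod 2) → ℂ)
    (h : ∀ (M : ℕ) (h : 2 ∣ M) [NeZero M] (A : ℤ), ∑ x, cuspTwist h f A x = 0) (a : ZMod 4) :
    ∑ x ∈ quadricTwo d a, f x = 0 := by
  refine sum_fiber_eq_zero qFour f (fun A => ?_) a
  have h2 : 2 ∣ 4 := by norm_num
  have h1 := h 4 h2 A
  rw [sum_cuspTwist, sum_mul_prod_localSum_four (c := 1) (a := A) h2 odd_one (by push_cast; ring)]
    at h1
  have h0 : localSum h2 A 0 = 2 := by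
    obtain ⟨hx, hcard⟩ := even_residues_four h2
    rw [localSum, Finset.sum_congr rfl (g := fun _ => (1 : ℂ)) fun x hx' => by
      rw [hx x (Finset.mem_filter.1 hx').2, mul_zero, AddChar.map_zero_eq_one],
      Finset.sum_const, hcard]
    simp
  rw [h0] at h1
  simpa using h1

/-- At the cusp `1/8` the even class cancels while odd squares are all 1 mod 8, so the cusp sum is a
nonzero multiple of `f (1,…,1)`. -/
theorem apply_one_eq_zero {d : ℕ} (f : (Fin d → ZMod 2) → ℂ)
    (h : ∀ (M : ℕ) (h : 2 ∣ M) [NeZero M] (A : ℤ), ∑ x, cuspTwist h f A x = 0) :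
    f (fun _ => 1) = 0 := by
  have h2 : 2 ∣ 8 := by norm_num
  have h1 := h 8 h2 1
  have h0 : localSum h2 1 0 = 0 :=
    localSum_zero_of_eight (g := 1) (a := 1) (c := 1) h2 odd_one odd_one (by simp) (by simp)
  have hl : localSum h2 1 1 = 4 * stdAddChar (1 : ZMod 8) := by
    obtain ⟨hx, hcard⟩ := odd_residues_eight h2
    rw [localSum, Finset.sum_congr rfl (g := fun _ => (stdAddChar (1 : ZMod 8) : ℂ))
      fun x hx' => by
        rw [hx x (Finset.mem_filter.1 hx').2, Int.cast_one, mul_one],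
      Finset.sum_const, hcard]
    simp
  have hne : ∀ r : ZMod 2, r ≠ 1 → r = 0 := by decide
  rw [sum_cuspTwist, Finset.sum_eq_single (fun _ => 1)] at h1
  · refine (mul_eq_zero.1 h1).resolve_right ?_
    rw [Finset.prod_const, hl]
    refine pow_ne_zero _ (mul_ne_zero (by norm_num) ?_)
    exact (AddChar.val_isUnit _ _).ne_zero
  · intro r _ hr
    obtain ⟨i, hi⟩ : ∃ i, r i ≠ 1 := by
      by_contra! h'
      exact hr (funext h')
    rw [Finset.prod_eq_zero (Finset.mem_univ i) (by rw [hne _ hi, h0]), mul_zero]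
  · simp

end WeightedTheta

end

theorem theorem1p4 (d : ℕ) (hd : 0 < d) :
    (∀ f : (Fin d → ZMod 2) → ℂ,
      WeightedTheta.IsCuspForm d WeightedTheta.levelTwo (WeightedTheta.theta f) ↔
        (∀ a : ZMod 4, ∑ x ∈ WeightedTheta.quadricTwo d a, f x = 0) ∧
          f (fun _ => 1) = 0 ∧ f (fun _ => 0) = 0) ∧
    (∀ (p : ℕ) [Fact p.Prime], p ≠ 2 → ∀ f : (Fin d → ZMod p) → ℂ,
      WeightedTheta.IsCuspForm d (WeightedTheta.levelOdd p) (WeightedTheta.theta f) ↔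
        (∀ a : ZMod p, ∑ x ∈ WeightedTheta.quadric p d a, f x = 0) ∧
          f (fun _ => 0) = 0) := by
  refine ⟨fun f => ?_, fun p _ hp f => ?_⟩
  · rw [WeightedTheta.isCuspForm_theta_iff f (WeightedTheta.isWeaklyModular_theta_levelTwo f)]
    exact ⟨fun h => ⟨WeightedTheta.sum_quadricTwo_eq_zero f h.2,
      WeightedTheta.apply_one_eq_zero f h.2, h.1⟩, fun h => ⟨h.2.2, fun _ hM _ A =>
      WeightedTheta.sum_cuspTwist_two_eq_zero hM f A h.1 h.2.1 h.2.2⟩⟩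
  · rw [WeightedTheta.isCuspForm_theta_iff f (WeightedTheta.isWeaklyModular_theta_levelOdd f)]
    exact ⟨fun h => ⟨WeightedTheta.sum_quadric_eq_zero f h.2, h.1⟩, fun h => ⟨h.2, fun _ hM _ A =>
      WeightedTheta.sum_cuspTwist_eq_zero_of_odd hM hp f A h.1 h.2⟩⟩
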